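/- Let $\mathcal T$ be an essentially small triangulated category with suspension $\Sigma$. Write $\operatorname{Coh}\mathcal T$ for the category of cohomological functors $\mathcal T^{\mathrm{op}}\to\mathrm{Ab}$, $H_X=\operatorname{Hom}_{\mathcal T}(-,X)$, and $\Sigma F=F\circ\Sigma^{-1}$ for $F\in\operatorname{Coh}\mathcal T$; a sequence in $\operatorname{Coh}\mathcal T$ is exact if it is exact at each object of $\mathcal T$. For a triangulated subcategory $\mathcal S\subseteq\mathcal T$ with Verdier quotient functor $q\colon\mathcal T\to\mathcal T/\mathcal S$, let $L_{\mathcal S}=q_*\circ q^*\colon\operatorname{Coh}\mathcal T\to\operatorname{Coh}\mathcal T$, where $q^*F=\operatorname{colim}_{H_X\to F}\operatorname{Hom}_{\mathcal T/\mathcal S}(-,q(X))$ and $q_*G=G\circ q$. An inclusion $\mathcal S\subseteq\mathcal S'$ induces a canonical functor $\mathcal T/\mathcal S\to\mathcal T/\mathcal S'$, hence canonical maps $\operatorname{Hom}_{\mathcal T/\mathcal S}(Y,X)\to\operatorname{Hom}_{\mathcal T/\mathcal S'}(Y,X)$ and a canonical morphism $L_{\mathcal S}\to L_{\mathcal S'}$.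 Let $\mathcal U,\mathcal V$ be thick subcategories of $\mathcal T$, let $\mathcal U\wedge\mathcal V$ be their intersection and $\mathcal U\vee\mathcal V$ the smallest thick subcategory containing both. The following are equivalent. (1) $\mathcal U$ and $\mathcal V$ commute: every morphism $U\to V$ and every morphism $V\to U$ with $U\in\mathcal U$ and $V\in\mathcal V$ factors through an object of $\mathcal U\wedge\mathcal V$. (2) There is a natural transformation $L_{\mathcal U\vee\mathcal V}\to\Sigma L_{\mathcal U\wedge\mathcal V}$ which, together with the map $L_{\mathcal U\wedge\mathcal V}\to L_{\mathcal U}\oplus L_{\mathcal V}$ whose components are the canonical morphisms and the map $L_{\mathcal U}\oplus L_{\mathcal V}\to L_{\mathcal U\vee\mathcal V}$ that is the difference of the canonical morphisms, gives a long exact sequence of functors on $\operatorname{Coh}\mathcal T$ $$\cdots\to\Sigma^{-1}L_{\mathcal U\vee\mathcal V}\to L_{\mathcal U\wedge\mathcal V}\to L_{\mathcal U}\oplus L_{\mathcal V}\to L_{\mathcal U\vee\mathcal V}\to\Sigma L_{\mathcal U\wedge\mathcal V}\to\cdots .$$ (3) For every $X\in\mathcal T$ there is a long exact sequence of functors on $\mathcal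 T^{\mathrm{op}}$ $$\cdots\to\operatorname{Hom}_{\mathcal T/(\mathcal U\wedge\mathcal V)}(-,\Sigma^nX)\to\operatorname{Hom}_{\mathcal T/\mathcal U}(-,\Sigma^nX)\oplus\operatorname{Hom}_{\mathcal T/\mathcal V}(-,\Sigma^nX)\to\operatorname{Hom}_{\mathcal T/(\mathcal U\vee\mathcal V)}(-,\Sigma^nX)\to\operatorname{Hom}_{\mathcal T/(\mathcal U\wedge\mathcal V)}(-,\Sigma^{n+1}X)\to\cdots\qquad(n\in\mathbb Z)$$ in which the first map has the canonical maps as components and the second map is the difference of the canonical maps. (4) There are sequences as in (3) for all $X$ whose connecting morphisms are moreover natural in $X$. (5) For each pair of objects $Y,X\in\mathcal T$ there is a long exact sequence of abelian groups with the terms of the sequence in (3) evaluated at $Y$, in which the maps $\operatorname{Hom}_{\mathcal T/(\mathcal U\wedge\mathcal V)}(Y,\Sigma^nX)\to\operatorname{Hom}_{\mathcal T/\mathcal U}(Y,\Sigma^nX)\oplus\operatorname{Hom}_{\mathcal T/\mathcal V}(Y,\Sigma^nX)$ have the canonical maps as components (the other maps being arbitrary homomorphisms). -/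

import Mathlib

open CategoryTheory Limits Opposite
open scoped Pretriangulated.Opposite

universe v u u'

namespace TriangulatedMV

section Size

variable {C : Type u} [Category.{v} C]

theorem locallySmall_presheaf [EssentiallySmall.{v} C] :
    LocallySmall.{v} (Cᵒᵖ ⥤ AddCommGrpCat.{v}) where
  hom_small F G := by
    let e := equivSmallModel.{v} C
    refine small_of_injective
      (β := ∀ Z : SmallModel.{v} C,
        F.obj (op (e.inverse.obj Z)) →+ G.obj (op (e.inverse.obj Z)))
      (f := fun τ Z => (τ.app (op (e.inverse.obj Z))).hom) ?_
    intro τ σ h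
    ext1
    funext X
    induction X using Opposite.rec with
    | op X =>
    have hZ : τ.app (op (e.inverse.obj (e.functor.obj X))) =
        σ.app (op (e.inverse.obj (e.functor.obj X))) := by
      ext1
      exact congrFun h (e.functor.obj X)
    let i : op (e.inverse.obj (e.functor.obj X)) ≅ op X := (e.unitIso.app X).op
    rw [← cancel_epi (F.map i.hom)]
    rw [τ.naturality, σ.naturality]
    exact congrArg (· ≫ G.map i.hom) hZ

variable [HasZeroObject C] [HasShift C ℤ] [Preadditive C]
  [∀ n : ℤ, (shiftFunctor C n).Additive] [Pretriangulated C] [IsTriangulated C]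

theorem locallySmall_localization [EssentiallySmall.{v} C] (S : ObjectProperty C)
    [S.IsTriangulated] : LocallySmall.{v} S.trW.Localization where
  hom_small X Y := by
    let e := equivSmallModel.{v} C
    have hX : S.trW.Q.obj (S.trW.Q.objPreimage X) ≅ X := S.trW.Q.objObjPreimageIso X
    have hY : S.trW.Q.obj (S.trW.Q.objPreimage Y) ≅ Y := S.trW.Q.objObjPreimageIso Y
    generalize S.trW.Q.objPreimage X = A at hX
    generalize S.trW.Q.objPreimage Y = B at hY
    refine small_of_surjective
      (α := Σ Z : SmallModel.{v} C, (A ⟶ e.inverse.obj Z) ×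
        {s : B ⟶ e.inverse.obj Z // S.trW s})
      (f := fun p => hX.inv ≫
        (MorphismProperty.LeftFraction.mk p.2.1 p.2.2.1 p.2.2.2).map S.trW.Q
          (Localization.inverts _ _) ≫ hY.hom) ?_
    intro f
    obtain ⟨φ, hφ⟩ := Localization.exists_leftFraction S.trW.Q S.trW (hX.hom ≫ f ≫ hY.inv)
    let i := e.unitIso.app φ.Y'
    refine ⟨⟨e.functor.obj φ.Y', φ.f ≫ i.hom,
      ⟨φ.s ≫ i.hom, S.trW.comp_mem _ _ φ.hs (S.trW_of_isIso _)⟩⟩, ?_⟩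
    rw [Iso.inv_comp_eq, ← Iso.eq_comp_inv, Category.assoc, hφ]
    have := Localization.inverts S.trW.Q S.trW _
      (S.trW.comp_mem _ _ φ.hs (S.trW_of_isIso i.hom))
    rw [← cancel_mono (S.trW.Q.map (φ.s ≫ i.hom))]
    erw [MorphismProperty.LeftFraction.map_comp_map_s]
    simp

end Size

section Coh

variable (C : Type u) [Category.{v} C] [HasZeroObject C] [HasShift C ℤ] [Preadditive C]
  [∀ n : ℤ, (shiftFunctor C n).Additive] [Pretriangulated C]

/-- The category `Coh C` of cohomological functors `Cᵒᵖ ⥤ Ab`, as a full subcategory of all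
functors. (The shift on `Cᵒᵖ` is the one for which `n` acts as `-n` on `C`; a functor is
homological on `Cᵒᵖ` if and only if it is cohomological on `C`.) -/
abbrev Coh : Type max u (v + 1) :=
  ObjectProperty.FullSubcategory
    (fun F : Cᵒᵖ ⥤ AddCommGrpCat.{v} => F.IsHomological)

/-- The Yoneda functor `X ↦ H_X = Hom(-, X)` with values in cohomological functors. -/
def cohYoneda : C ⥤ Coh C :=
  ObjectProperty.lift _ preadditiveYoneda (fun X => by infer_instance)

variable {C}

instance (F : Coh C) : F.obj.IsHomological := F.property

instance [EssentiallySmall.{v} C] : LocallySmall.{v} (Coh C) :=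
  have := locallySmall_presheaf (C := C)
  inferInstance

/-- The suspension of `Coh C`, sending `F` to `F ∘ Σ⁻¹`. -/
def cohSuspension : Coh C ⥤ Coh C :=
  ObjectProperty.lift _
    (ObjectProperty.ι _ ⋙ (Functor.whiskeringLeft _ _ _).obj (shiftFunctor C (-1 : ℤ)).op)
    (fun F => by
      let : F.obj.ShiftSequence ℤ := Functor.ShiftSequence.tautological _ _
      have : (shiftFunctor Cᵒᵖ (1 : ℤ) ⋙ F.obj).IsHomological :=
        { toPreservesZeroMorphisms := inferInstance
          exact := fun T hT => F.obj.homologySequence_exact₂ T hT 1 }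
      exact Functor.IsHomological.of_iso (F₁ := shiftFunctor Cᵒᵖ (1 : ℤ) ⋙ F.obj)
        (Functor.isoWhiskerRight (Pretriangulated.shiftFunctorOpIso C 1 (-1) (by omega)) F.obj))

/-- The natural transformation `H_X ⟶ F` attached to `x ∈ F(X)`. -/
def ofElem (F : Coh C) {X : C} (x : F.obj.obj (op X)) : (cohYoneda C).obj X ⟶ F where
  hom :=
    { app := fun Y => AddCommGrpCat.ofHom
        { toFun := fun (f : Y.unop ⟶ X) => F.obj.map f.op x
          map_zero' := by
            have := F.obj.map_zero (op X) Y
            exact ConcreteCategory.congr_hom this x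
          map_add' := fun f g => by
            have : F.obj.map (f.op + g.op) = _ := F.obj.map_add
            exact ConcreteCategory.congr_hom this x }
      naturality := fun Y Z f => by
        ext g
        exact ConcreteCategory.congr_hom
          (F.obj.map_comp (Quiver.Hom.op (show Y.unop ⟶ X from g)) f) x }

theorem ofElem_surj (F : Coh C) {X : C} (φ : (cohYoneda C).obj X ⟶ F) :
    ∃ x, ofElem F x = φ := by
  refine ⟨φ.hom.app (op X) (𝟙 X), ?_⟩
  ext Y g
  have := ConcreteCategory.congr_hom
    (φ.hom.naturality (Quiver.Hom.op (show Y.unop ⟶ X from g))) (𝟙 X)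
  refine this.symm.trans (congrArg (φ.hom.app Y) ?_)
  exact Category.comp_id (show Y.unop ⟶ X from g)

theorem map_ofElem (F : Coh C) {X Y : C} (a : X ⟶ Y) (y : F.obj.obj (op Y)) :
    (cohYoneda C).map a ≫ ofElem F y = ofElem F (F.obj.map a.op y) := by
  ext Z g
  exact ConcreteCategory.congr_hom
    (F.obj.map_comp a.op (Quiver.Hom.op (show Z.unop ⟶ X from g))) y

theorem ofElem_injective (F : Coh C) {X : C} {x y : F.obj.obj (op X)}
   (h : ofElem F x = ofElem F y) : x = y := by
  have : (ofElem F x).hom.app (op X) (𝟙 X) = (ofElem F y).hom.app (op X) (𝟙 X) := by rw [h]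
  change F.obj.map (𝟙 X).op x = F.obj.map (𝟙 X).op y at this
  simpa using this

/-- The slice category `C / F` of a cohomological functor is filtered. -/
instance isFiltered_slice (F : Coh C) : IsFiltered (CostructuredArrow (cohYoneda C) F) where
  nonempty := ⟨CostructuredArrow.mk (Y := (HasZeroObject.zero' C).zero) (ofElem F 0)⟩
  cocone_objs := fun P Q => by
    obtain ⟨X, f, rfl⟩ := P.mk_surjective
    obtain ⟨Y, g, rfl⟩ := Q.mk_surjective
    obtain ⟨x, rfl⟩ := ofElem_surj F f
    obtain ⟨y, rfl⟩ := ofElem_surj F g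
    refine ⟨CostructuredArrow.mk (Y := X ⊞ Y)
      (ofElem F (F.obj.map (biprod.fst : X ⊞ Y ⟶ X).op x +
        F.obj.map (biprod.snd : X ⊞ Y ⟶ Y).op y)),
      CostructuredArrow.homMk biprod.inl ?_, CostructuredArrow.homMk biprod.inr ?_, trivial⟩
    all_goals
      dsimp
      rw [map_ofElem]
      simp [← ConcreteCategory.comp_apply, ← Functor.map_comp, ← op_comp]
  cocone_maps := fun P Q a b => by
    obtain ⟨X, f, rfl⟩ := P.mk_surjective
    obtain ⟨Y, g, rfl⟩ := Q.mk_surjective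
    obtain ⟨y, rfl⟩ := ofElem_surj F g
    obtain ⟨α, hα⟩ : ∃ α : X ⟶ Y, α = a.left := ⟨_, rfl⟩
    obtain ⟨β, hβ⟩ : ∃ β : X ⟶ Y, β = b.left := ⟨_, rfl⟩
    obtain ⟨Z, k, l, hT⟩ := Pretriangulated.distinguished_cocone_triangle (α - β)
    have ha := CostructuredArrow.w a
    have hb := CostructuredArrow.w b
    dsimp at ha hb
    rw [← hα, map_ofElem] at ha
    rw [← hβ, map_ofElem] at hb
    have hab := ofElem_injective F (ha.trans hb.symm)
    have hy : F.obj.map (α - β).op y = 0 := by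
      simp [op_sub, F.obj.map_sub, hab]
    obtain ⟨z, hz⟩ := (ShortComplex.ab_exact_iff _).1
      (F.obj.map_distinguished_op_exact _ hT) y hy
    change F.obj.obj (op Z) at z
    refine ⟨CostructuredArrow.mk (Y := Z) (ofElem F z), CostructuredArrow.homMk k ?_, ?_⟩
    · exact (map_ofElem F k z).trans (congrArg _ hz)
    · ext
      have : (α - β) ≫ k = 0 := Pretriangulated.comp_distTriang_mor_zero₁₂ _ hT
      rw [Preadditive.sub_comp, sub_eq_zero, hα, hβ] at this
      exact this

variable {D : Type u'} [Category.{v} D] [HasZeroObject D] [HasShift D ℤ] [Preadditive D]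
  [∀ n : ℤ, (shiftFunctor D n).Additive] [Pretriangulated D]

theorem colimit_isHomological {J : Type*} [Category* J] [IsFiltered J] [EssentiallySmall.{v} J]
    (K : J ⥤ Dᵒᵖ ⥤ AddCommGrpCat.{v}) (hK : ∀ j, (K.obj j).IsHomological)
    (c : Cocone K) (hc : IsColimit c) : c.pt.IsHomological := by
  have hcol : HasColimitsOfShape J AddCommGrpCat.{v} :=
    hasColimitsOfShape_of_essentiallySmall J _
  have hex : HasExactColimitsOfShape J AddCommGrpCat.{v} :=
    have : IsFiltered (SmallModel.{v} J) := .of_equivalence (equivSmallModel J)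
    HasExactColimitsOfShape.of_domain_equivalence _ (equivSmallModel.{v} J).symm
  have hcX := fun X => isColimitOfPreserves ((evaluation Dᵒᵖ AddCommGrpCat.{v}).obj X) hc
  have : c.pt.PreservesZeroMorphisms := ⟨fun X Y => (hcX X).hom_ext (fun j => by
    have := (c.ι.app j).naturality (0 : X ⟶ Y)
    simp at this
    simpa using this.symm)⟩
  refine { exact := fun T hT => ?_ }
  let S := Pretriangulated.shortComplexOfDistTriangle T hT
  let S' : ShortComplex (J ⥤ AddCommGrpCat.{v}) :=
    ShortComplex.mk (X₁ := K ⋙ (evaluation _ _).obj S.X₁) (X₂ := K ⋙ (evaluation _ _).obj S.X₂)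
      (X₃ := K ⋙ (evaluation _ _).obj S.X₃)
      (Functor.whiskerLeft K ((evaluation _ _).map S.f))
      (Functor.whiskerLeft K ((evaluation _ _).map S.g))
      (by
        ext j : 2
        have := hK j
        simp [← Functor.map_comp])
  have hS' : S'.Exact := by
    rw [ShortComplex.exact_iff_isZero_homology]
    refine Functor.isZero _ (fun j => ?_)
    have := hK j
    exact ((ShortComplex.exact_iff_isZero_homology _).1
      ((K.obj j).map_distinguished_exact T hT)).of_iso
        (S'.mapHomologyIso ((evaluation J AddCommGrpCat.{v}).obj j)).symm
  exact colim.exact_mapShortComplex hS' (hcX S.X₁) (hcX S.X₂) (hcX S.X₃) (c.pt.map S.f) (c.pt.map S.g)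
   (fun j => by simp [S']) (fun j => by simp [S'])

instance hasColimits_slice [EssentiallySmall.{v} C] (F : Coh C) :
    HasColimitsOfShape (CostructuredArrow (cohYoneda C) F) (Dᵒᵖ ⥤ AddCommGrpCat.{v}) :=
  have := hasColimitsOfShape_of_essentiallySmall.{v}
    (CostructuredArrow (cohYoneda C) F) AddCommGrpCat.{v}
  inferInstance

instance hasPointwise [EssentiallySmall.{v} C] (G : C ⥤ Dᵒᵖ ⥤ AddCommGrpCat.{v}) :
    (cohYoneda C).HasPointwiseLeftKanExtension G :=
  fun _ => inferInstance

/-- The functor `f^* : Coh C ⥤ Coh D` induced by `f : C ⥤ D`: it sends `F` to the colimit of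
`H_{f(X)}` over the slice category of all morphisms `H_X ⟶ F`. -/
noncomputable def cohExtend [EssentiallySmall.{v} C] (f : C ⥤ D) : Coh C ⥤ Coh D :=
  ObjectProperty.lift _ ((cohYoneda C).pointwiseLeftKanExtension (f ⋙ preadditiveYoneda))
    (fun F => colimit_isHomological
      (CostructuredArrow.proj (cohYoneda C) F ⋙ f ⋙ preadditiveYoneda)
      (fun P => inferInstanceAs (preadditiveYoneda.obj (f.obj P.left)).IsHomological)
      _ (colimit.isColimit _))

/-- The functor `f_* : Coh D ⥤ Coh C` induced by an exact functor `f : C ⥤ D`, `G ↦ G ∘ f`. -/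
def cohRestrict (f : C ⥤ D) [f.CommShift ℤ] [f.IsTriangulated] : Coh D ⥤ Coh C :=
  ObjectProperty.lift _ (ObjectProperty.ι _ ⋙ (Functor.whiskeringLeft _ _ _).obj f.op)
    (fun G => inferInstanceAs (f.op ⋙ G.obj).IsHomological)

end Coh

section Localisation

variable {C : Type u} [Category.{v} C] [HasZeroObject C] [HasShift C ℤ] [Preadditive C]
  [∀ n : ℤ, (shiftFunctor C n).Additive] [Pretriangulated C] [IsTriangulated C]
  [EssentiallySmall.{v} C]

noncomputable instance hasLocalization (S : ObjectProperty C) [S.IsTriangulated] :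
    MorphismProperty.HasLocalization.{v} S.trW :=
  have := locallySmall_localization S
  MorphismProperty.hasLocalizationOfLocallySmall.{v} S.trW S.trW.Q

/-- The Verdier quotient `C / S`: the localization of `C` at the morphisms with cone in `S`
(with morphism groups in the same universe as those of `C`). -/
abbrev VerdierQuotient (S : ObjectProperty C) [S.IsTriangulated] : Type u :=
  S.trW.Localization'

/-- The quotient functor `C ⥤ C / S`. -/
noncomputable abbrev quotientFunctor (S : ObjectProperty C) [S.IsTriangulated] :
    C ⥤ VerdierQuotient S :=
  S.trW.Q'

/-- The localisation functor `L_S = q_* ∘ q^*` on `Coh C`, for `q : C ⥤ C / S`. -/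
noncomputable def locFunctor (S : ObjectProperty C) [S.IsTriangulated] : Coh C ⥤ Coh C :=
  cohExtend (quotientFunctor S) ⋙ cohRestrict (quotientFunctor S)

/-- The group of morphisms `Y ⟶ X` in `C / S`. -/
abbrev QuotientHom (S : ObjectProperty C) [S.IsTriangulated] (Y X : C) : Type v :=
  (quotientFunctor S).obj Y ⟶ (quotientFunctor S).obj X

/-- The functor sending `X` to `Hom_{C / S}(-, X)`, viewed as a functor on `Cᵒᵖ`. -/
noncomputable def quotientYoneda (S : ObjectProperty C) [S.IsTriangulated] :
    C ⥤ Cᵒᵖ ⥤ AddCommGrpCat.{v} :=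
  quotientFunctor S ⋙ preadditiveYoneda ⋙
    (Functor.whiskeringLeft _ _ _).obj (quotientFunctor S).op

section

variable {S S' : ObjectProperty C} [S.IsTriangulated] [S'.IsTriangulated] (h : S ≤ S')

/-- The canonical functor `C / S ⥤ C / S'` for `S ≤ S'`. -/
noncomputable def quotientMap : VerdierQuotient S ⥤ VerdierQuotient S' :=
  Localization.lift (quotientFunctor S') (fun _ _ s hs =>
    Localization.inverts (quotientFunctor S') S'.trW s (ObjectProperty.trW_monotone h s hs))
    (quotientFunctor S)

/-- The canonical functor `C / S ⥤ C / S'` is compatible with the quotient functors. -/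
noncomputable def quotientMapIso :
    quotientFunctor S ⋙ quotientMap h ≅ quotientFunctor S' :=
  Localization.fac _ _ _

instance : (quotientMap h).Additive := by
  rw [Localization.functor_additive_iff (quotientFunctor S) S.trW]
  exact Functor.additive_of_iso (quotientMapIso h).symm

/-- The canonical map `Hom_{C / S}(Y, X) → Hom_{C / S'}(Y, X)` for `S ≤ S'`. -/
noncomputable def quotientHomMap (Y X : C) : QuotientHom S Y X →+ QuotientHom S' Y X :=
  AddMonoidHom.mk' (fun f => (quotientMapIso h).inv.app Y ≫ (quotientMap h).map f ≫
    (quotientMapIso h).hom.app X) (fun f g => by simp [Functor.map_add])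

theorem quotientHomMap_precomp {Z Y X : C} (a : Z ⟶ Y) (f : QuotientHom S Y X) :
    quotientHomMap h Z X ((quotientFunctor S).map a ≫ f) =
      (quotientFunctor S').map a ≫ quotientHomMap h Y X f := by
  have := (quotientMapIso h).inv.naturality a
  dsimp at this
  simp [quotientHomMap, reassoc_of% this]

theorem quotientHomMap_postcomp {Y X X' : C} (f : QuotientHom S Y X) (a : X ⟶ X') :
    quotientHomMap h Y X' (f ≫ (quotientFunctor S).map a) =
      quotientHomMap h Y X f ≫ (quotientFunctor S').map a := by
  have := (quotientMapIso h).hom.naturality a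
  dsimp at this
  simp [quotientHomMap, this]

theorem quotientHomMap_map {Y X : C} (f : Y ⟶ X) :
    quotientHomMap h Y X ((quotientFunctor S).map f) = (quotientFunctor S').map f := by
  have := (quotientMapIso h).hom.naturality f
  dsimp at this
  simp [quotientHomMap, this]

/-- The canonical maps `Hom_{C / S}(Y, X) → Hom_{C / S'}(Y, X)`, as a natural transformation. -/
noncomputable def quotientYonedaMap : quotientYoneda S ⟶ quotientYoneda S' where
  app X :=
    { app := fun Y => AddCommGrpCat.ofHom (quotientHomMap h Y.unop X)
      naturality := fun Y Z f => by
        ext g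
        exact quotientHomMap_precomp h f.unop g }
  naturality X X' a := by
    ext Y g
    exact quotientHomMap_postcomp h (show QuotientHom S Y.unop X from g) a

end

/-- The canonical morphisms `Hom_{C / S}(-, X) ⟶ L_S H_X` (they are isomorphisms). -/
noncomputable def locUnit (S : ObjectProperty C) [S.IsTriangulated] :
    quotientYoneda S ⟶ cohYoneda C ⋙ locFunctor S ⋙ ObjectProperty.ι _ :=
  Functor.whiskerRight
    ((cohYoneda C).pointwiseLeftKanExtensionUnit (quotientFunctor S ⋙ preadditiveYoneda))
    ((Functor.whiskeringLeft _ _ _).obj (quotientFunctor S).op)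

/-- `L_S` is determined by its values on representable functors: for every `F`, the functor
`L_S F` is the colimit of `Hom_{C / S}(-, X)` over all morphisms `H_X ⟶ F`. -/
noncomputable def locUnitIsPointwise (S : ObjectProperty C) [S.IsTriangulated] :
    (Functor.LeftExtension.mk (locFunctor S ⋙ ObjectProperty.ι _)
      (locUnit S)).IsPointwiseLeftKanExtension := fun F =>
  have := hasColimitsOfShape_of_essentiallySmall.{v}
    (CostructuredArrow (cohYoneda C) F) AddCommGrpCat.{v}
  isColimitOfPreserves
    ((Functor.whiskeringLeft _ _ AddCommGrpCat.{v}).obj (quotientFunctor S).op)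
    ((cohYoneda C).pointwiseLeftKanExtensionIsPointwiseLeftKanExtension
      (quotientFunctor S ⋙ preadditiveYoneda) F)

instance locFunctor_isLeftKanExtension (S : ObjectProperty C) [S.IsTriangulated] :
    (locFunctor S ⋙ ObjectProperty.ι _).IsLeftKanExtension (locUnit S) :=
  (locUnitIsPointwise S).isLeftKanExtension

/-- The canonical morphism `L_S ⟶ L_{S'}` for `S ≤ S'`: the unique one that is given on
representable functors by the canonical maps `Hom_{C / S}(-, X) ⟶ Hom_{C / S'}(-, X)`. -/
noncomputable def locMap {S S' : ObjectProperty C} [S.IsTriangulated] [S'.IsTriangulated]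
    (h : S ≤ S') : locFunctor S ⟶ locFunctor S' :=
  ((Functor.FullyFaithful.whiskeringRight (ObjectProperty.fullyFaithfulι _) (Coh C)).preimage
    ((locFunctor S ⋙ ObjectProperty.ι _).descOfIsLeftKanExtension (locUnit S)
      (locFunctor S' ⋙ ObjectProperty.ι _) (quotientYonedaMap h ≫ locUnit S')))

theorem locUnit_locMap {S S' : ObjectProperty C} [S.IsTriangulated] [S'.IsTriangulated]
    (h : S ≤ S') :
    locUnit S ≫ Functor.whiskerLeft (cohYoneda C)
      (Functor.whiskerRight (locMap h) (ObjectProperty.ι _)) =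
        quotientYonedaMap h ≫ locUnit S' :=
  (locFunctor S ⋙ ObjectProperty.ι _).descOfIsLeftKanExtension_fac (locUnit S) _ _

/-- The canonical map `(L_S F)(Y) → (L_{S'} F)(Y)` for `S ≤ S'`. -/
noncomputable def locMapApp {S S' : ObjectProperty C} [S.IsTriangulated] [S'.IsTriangulated]
    (h : S ≤ S') (F : Coh C) (Y : C) :
    ((locFunctor S).obj F).obj.obj (op Y) →+ ((locFunctor S').obj F).obj.obj (op Y) :=
  (((locMap h).app F).hom.app (op Y)).hom

end Localisation

section MayerVietoris

variable {C : Type u} [Category.{v} C] [HasZeroObject C] [HasShift C ℤ] [Preadditive C]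
  [∀ n : ℤ, (shiftFunctor C n).Additive] [Pretriangulated C]

/-- The join `U ∨ V`: the smallest thick subcategory containing `U` and `V`.
(The meet `U ∧ V` is the intersection `U ⊓ V`.) -/
abbrev thickJoin (U V : ObjectProperty C) : ObjectProperty C :=
  (U ⊔ V).triangEnvelope

/-- `U` and `V` commute: every morphism between objects of `U` and `V`, in either direction,
factors through an object of `U ∧ V`. -/
def Commuting (U V : ObjectProperty C) : Prop :=
  (∀ ⦃X Y : C⦄ (f : X ⟶ Y), U X → V Y →
    ∃ (Z : C) (g : X ⟶ Z) (h : Z ⟶ Y), (U ⊓ V) Z ∧ g ≫ h = f) ∧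
  (∀ ⦃X Y : C⦄ (f : X ⟶ Y), V X → U Y →
    ∃ (Z : C) (g : X ⟶ Z) (h : Z ⟶ Y), (U ⊓ V) Z ∧ g ≫ h = f)

variable (U V : ObjectProperty C)

theorem left_le_thickJoin : U ≤ thickJoin U V :=
  le_sup_left.trans (U ⊔ V).le_triangEnvelope

theorem right_le_thickJoin : V ≤ thickJoin U V :=
  le_sup_right.trans (U ⊔ V).le_triangEnvelope

variable [IsTriangulated C] [EssentiallySmall.{v} C] [U.IsTriangulated] [U.IsStableUnderRetracts]
  [V.IsTriangulated] [V.IsStableUnderRetracts]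

/-- The map `L_{U ∧ V} F → L_U F ⊕ L_V F`, evaluated at `Y`, with components the canonical
maps. -/
noncomputable def locToSum (F : Coh C) (Y : C) :
    ((locFunctor (U ⊓ V)).obj F).obj.obj (op Y) →+
      ((locFunctor U).obj F).obj.obj (op Y) × ((locFunctor V).obj F).obj.obj (op Y) :=
  (locMapApp (inf_le_left : U ⊓ V ≤ U) F Y).prod (locMapApp (inf_le_right : U ⊓ V ≤ V) F Y)

/-- The map `L_U F ⊕ L_V F → L_{U ∨ V} F`, evaluated at `Y`, the difference of the canonical
maps. -/
noncomputable def locFromSum (F : Coh C) (Y : C) :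
    ((locFunctor U).obj F).obj.obj (op Y) × ((locFunctor V).obj F).obj.obj (op Y) →+
      ((locFunctor (thickJoin U V)).obj F).obj.obj (op Y) :=
  (locMapApp (left_le_thickJoin U V) F Y).coprod (-(locMapApp (right_le_thickJoin U V) F Y))

/-- There is a connecting morphism `δ : L_{U ∨ V} ⟶ Σ L_{U ∧ V}` of functors on `Coh C` that
makes `L_{U ∧ V} ⟶ L_U ⊕ L_V ⟶ L_{U ∨ V} ⟶ Σ L_{U ∧ V} ⟶ Σ L_U ⊕ Σ L_V` exact. A sequence in
`Coh C` is exact when it is exact at every object `Y`, and `(Σ G)(Y) = G(Σ⁻¹ Y)`; as `Y` runs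
through all objects, and hence through all their shifts, this is the exactness of the whole long
sequence of all `Σⁿ`. -/
def LocMayerVietoris : Prop :=
  ∃ δ : locFunctor (thickJoin U V) ⟶ locFunctor (U ⊓ V) ⋙ cohSuspension,
    ∀ (F : Coh C) (Y : C),
      Function.Exact (locToSum U V F Y) (locFromSum U V F Y) ∧
      Function.Exact (locFromSum U V F Y) ((δ.app F).hom.app (op Y)) ∧
      Function.Exact ((δ.app F).hom.app (op Y)) (locToSum U V F (Y⟦(-1 : ℤ)⟧))

/-- The map `Hom_{C/(U ∧ V)}(Y, X) → Hom_{C/U}(Y, X) ⊕ Hom_{C/V}(Y, X)` with components the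
canonical maps. -/
noncomputable def homToSum (Y X : C) :
    QuotientHom (U ⊓ V) Y X →+ QuotientHom U Y X × QuotientHom V Y X :=
  (quotientHomMap (inf_le_left : U ⊓ V ≤ U) Y X).prod
    (quotientHomMap (inf_le_right : U ⊓ V ≤ V) Y X)

/-- The map `Hom_{C/U}(Y, X) ⊕ Hom_{C/V}(Y, X) → Hom_{C/(U ∨ V)}(Y, X)`, the difference of the
canonical maps. -/
noncomputable def homFromSum (Y X : C) :
    QuotientHom U Y X × QuotientHom V Y X →+ QuotientHom (thickJoin U V) Y X :=
  (quotientHomMap (left_le_thickJoin U V) Y X).coprod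
    (-(quotientHomMap (right_le_thickJoin U V) Y X))

/-- For the object `X` there are connecting morphisms, natural in the first variable, that make
the sequence of functors `⋯ → Hom_{C/(U ∧ V)}(-, Σⁿ X) → Hom_{C/U}(-, Σⁿ X) ⊕ Hom_{C/V}(-, Σⁿ X)
→ Hom_{C/(U ∨ V)}(-, Σⁿ X) → Hom_{C/(U ∧ V)}(-, Σⁿ⁺¹ X) → ⋯` exact. -/
def HomMayerVietoris (X : C) : Prop :=
  ∃ δ : ∀ n : ℤ, (quotientYoneda (thickJoin U V)).obj (X⟦n⟧) ⟶
      (quotientYoneda (U ⊓ V)).obj (X⟦n + 1⟧),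
    ∀ (n : ℤ) (Y : C),
      Function.Exact (homToSum U V Y (X⟦n⟧)) (homFromSum U V Y (X⟦n⟧)) ∧
      Function.Exact (homFromSum U V Y (X⟦n⟧)) ((δ n).app (op Y)) ∧
      Function.Exact ((δ n).app (op Y)) (homToSum U V Y (X⟦n + 1⟧))

/-- There are connecting morphisms `Hom_{C/(U ∨ V)}(Y, Σⁿ X) → Hom_{C/(U ∧ V)}(Y, Σⁿ⁺¹ X)`,
natural in `X` and `Y`, that make the long sequences of the preceding definition exact for
all `X`. -/
def NaturalHomMayerVietoris : Prop :=
  ∃ δ : ∀ n : ℤ, shiftFunctor C n ⋙ quotientYoneda (thickJoin U V) ⟶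
      shiftFunctor C (n + 1) ⋙ quotientYoneda (U ⊓ V),
    ∀ (X : C) (n : ℤ) (Y : C),
      Function.Exact (homToSum U V Y (X⟦n⟧)) (homFromSum U V Y (X⟦n⟧)) ∧
      Function.Exact (homFromSum U V Y (X⟦n⟧)) (((δ n).app X).app (op Y)) ∧
      Function.Exact (((δ n).app X).app (op Y)) (homToSum U V Y (X⟦n + 1⟧))

/-- For the pair of objects `Y, X` there is a long exact sequence of abelian groups
`⋯ → Hom_{C/(U ∧ V)}(Y, Σⁿ X) → Hom_{C/U}(Y, Σⁿ X) ⊕ Hom_{C/V}(Y, Σⁿ X) →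
Hom_{C/(U ∨ V)}(Y, Σⁿ X) → Hom_{C/(U ∧ V)}(Y, Σⁿ⁺¹ X) → ⋯` whose first map has the canonical
maps as components; nothing is required of the other maps. -/
def PointwiseHomMayerVietoris (Y X : C) : Prop :=
  ∃ (β : ∀ n : ℤ, QuotientHom U Y (X⟦n⟧) × QuotientHom V Y (X⟦n⟧) →+
      QuotientHom (thickJoin U V) Y (X⟦n⟧))
    (δ : ∀ n : ℤ, QuotientHom (thickJoin U V) Y (X⟦n⟧) →+ QuotientHom (U ⊓ V) Y (X⟦n + 1⟧)),
    ∀ n : ℤ,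
      Function.Exact (homToSum U V Y (X⟦n⟧)) (β n) ∧
      Function.Exact (β n) (δ n) ∧
      Function.Exact (δ n) (homToSum U V Y (X⟦n + 1⟧))

end MayerVietoris

end TriangulatedMV

namespace TriangulatedMV

open Pretriangulated
open scoped ZeroObject

/-! ### Morphisms in a Verdier quotient and the kernels of the canonical maps. -/

section Quotient

variable {C : Type u} [Category.{v} C] [HasZeroObject C] [HasShift C ℤ] [Preadditive C]
  [∀ n : ℤ, (shiftFunctor C n).Additive] [Pretriangulated C] [IsTriangulated C]
  [EssentiallySmall.{v} C]

section

variable (S : ObjectProperty C) [S.IsTriangulated]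

/-! Write `W = U ∧ V` and `J = U ∨ V`. If `U` and `V` commute, then `C / W` has no nonzero morphisms
between `U` and `V`. The octahedral axiom gives `V * U ≤ U * V` for extension products, so every
object of `J` is a retract of some `Z` in a triangle `u ⟶ Z ⟶ v ⟶ u⟦1⟧`. Its last map factors
through `W`, hence vanishes in `C / W`, and each object of `J` splits there, naturally, into a part
in `U` and a part in `V` (`Commuting.isSplit`).

This splitting yields the connecting map. A morphism `Y ⟶ X` of `C / J` is a fraction of `f : Y ⟶
X'` and `s : X ⟶ X'` with cone `Z` in `J`; it is sent to the composite `Y ⟶ X' ⟶ Z ⟶ Z ⟶ X⟦1⟧` in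
which the endomorphism of `Z` is the projection to the `U`-part. Naturality of the splitting makes
this well defined and natural (`IsSplit.isBoundary_unique`), and exactness reduces to three chases:
`IsSplit.exists_lift`, `IsSplit.isBoundary_zero_iff`, `IsSplit.exists_isBoundary_iff`. As `L_S F` is
a filtered colimit of the functors `Hom_{C/S}(-, X)`, exactness passes to the localisation functors.

Conversely, a morphism between `U` and `V` dies in both `C / U` and `C / V`. By exactness, its image
in `C / W` comes from a morphism group of `C / J` whose source lies in `J`, and that group is zero.
So the morphism dies in `C / W`, that is, it factors through `W`. -/

theorem isIso_quotientFunctor_map {X Y : C} (s : X ⟶ Y) (hs : S.trW s) :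
    IsIso ((quotientFunctor S).map s) :=
  Localization.inverts (quotientFunctor S) S.trW s hs

theorem exists_quotientHom_comp_map_eq {Y X : C} (f : QuotientHom S Y X) :
    ∃ (X' : C) (s : X ⟶ X') (g : Y ⟶ X'), S.trW s ∧
      f ≫ (quotientFunctor S).map s = (quotientFunctor S).map g := by
  obtain ⟨φ, rfl⟩ := Localization.exists_leftFraction (quotientFunctor S) S.trW f
  exact ⟨φ.Y', φ.s, φ.f, φ.hs, φ.map_comp_map_s _ _⟩

theorem exists_map_comp_quotientHom_eq {Y X : C} (f : QuotientHom S Y X) :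
    ∃ (Y' : C) (s : Y' ⟶ Y) (g : Y' ⟶ X), S.trW s ∧
      (quotientFunctor S).map s ≫ f = (quotientFunctor S).map g := by
  obtain ⟨φ, rfl⟩ := Localization.exists_rightFraction (quotientFunctor S) S.trW f
  exact ⟨φ.X', φ.s, φ.f, φ.hs, φ.map_s_comp_map _ _⟩

/-- Some `t` with fibre in `S` kills `f`, so `f` factors through that fibre. -/
theorem exists_comp_eq_zero_of_map_eq_zero {Y X : C} (f : Y ⟶ X)
    (hf : (quotientFunctor S).map f = 0) :
    ∃ (Z : C) (a : Y ⟶ Z) (b : Z ⟶ X), S Z ∧ a ≫ b = f := by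
  obtain ⟨X', t, ht, h⟩ := (MorphismProperty.map_eq_iff_postcomp (quotientFunctor S) S.trW
    f 0).1 (by simpa using hf)
  rw [zero_comp] at h
  obtain ⟨Z, b, c, hT, hZ⟩ := (S.trW_iff' t).1 ht
  obtain ⟨a, ha⟩ := Triangle.coyoneda_exact₂ _ hT f h
  exact ⟨Z, a, b, hZ, ha.symm⟩

theorem isZero_quotientFunctor_obj {Z : C} (hZ : S Z) : IsZero ((quotientFunctor S).obj Z) := by
  have := isIso_quotientFunctor_map S (0 : Z ⟶ 0)
    ((S.trW_iff' _).2 ⟨Z, 𝟙 Z, 0, contractible_distinguished Z, hZ⟩)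
  exact ((quotientFunctor S).map_isZero (isZero_zero C)).of_iso
    (asIso ((quotientFunctor S).map (0 : Z ⟶ 0)))

theorem quotientHom_eq_zero_left {Z X : C} (hZ : S Z) (f : QuotientHom S Z X) : f = 0 :=
  (isZero_quotientFunctor_obj S hZ).eq_of_src _ _

theorem exists_lift_of_distTriang {Y X X' Z : C} {s : X ⟶ X'} {h : X' ⟶ Z} {k : Z ⟶ X⟦(1 : ℤ)⟧}
    (hT : Triangle.mk s h k ∈ distTriang C) (f : QuotientHom S Y X')
    (hf : f ≫ (quotientFunctor S).map h = 0) :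
    ∃ g : QuotientHom S Y X, g ≫ (quotientFunctor S).map s = f := by
  obtain ⟨g, hg⟩ := Triangle.coyoneda_exact₂ _ ((quotientFunctor S).map_distinguished _ hT) f hf
  exact ⟨g, hg.symm⟩

theorem exists_lift_of_distTriang' {Y X X' Z : C} {s : X ⟶ X'} {h : X' ⟶ Z} {k : Z ⟶ X⟦(1 : ℤ)⟧}
    (hT : Triangle.mk s h k ∈ distTriang C) (f : QuotientHom S Y Z)
    (hf : f ≫ (quotientFunctor S).map k = 0) :
    ∃ g : QuotientHom S Y X', g ≫ (quotientFunctor S).map h = f :=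
  exists_lift_of_distTriang S (rot_of_distTriang _ hT) f hf

theorem map_comp_map_eq_zero_of_distTriang {X X' Z : C} {s : X ⟶ X'} {h : X' ⟶ Z}
    {k : Z ⟶ X⟦(1 : ℤ)⟧} (hT : Triangle.mk s h k ∈ distTriang C) :
    (quotientFunctor S).map s ≫ (quotientFunctor S).map h = 0 := by
  have : s ≫ h = 0 := comp_distTriang_mor_zero₁₂ _ hT
  rw [← Functor.map_comp, this, Functor.map_zero]

theorem map_comp_map_eq_zero_of_distTriang' {X X' Z : C} {s : X ⟶ X'} {h : X' ⟶ Z}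
    {k : Z ⟶ X⟦(1 : ℤ)⟧} (hT : Triangle.mk s h k ∈ distTriang C) :
    (quotientFunctor S).map h ≫ (quotientFunctor S).map k = 0 :=
  map_comp_map_eq_zero_of_distTriang S (rot_of_distTriang _ hT)

end

section

variable {S S' : ObjectProperty C} [S.IsTriangulated] [S'.IsTriangulated] (h : S ≤ S')

theorem quotientHomMap_comp {Y X Z : C} (f : QuotientHom S Y X) (g : QuotientHom S X Z) :
    quotientHomMap h Y Z (f ≫ g) = quotientHomMap h Y X f ≫ quotientHomMap h X Z g := by
  simp [quotientHomMap]

/-- After composing with a denominator of `f`, all three maps are evaluated on a morphism of `C`,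
where they agree; the chosen isomorphisms `quotientMapIso` need no comparison. -/
theorem quotientHomMap_quotientHomMap {S'' : ObjectProperty C} [S''.IsTriangulated]
    (h' : S' ≤ S'') (h'' : S ≤ S'') {Y X : C} (f : QuotientHom S Y X) :
    quotientHomMap h' Y X (quotientHomMap h Y X f) = quotientHomMap h'' Y X f := by
  obtain ⟨X', s, g, hs, hf⟩ := exists_quotientHom_comp_map_eq S f
  have := isIso_quotientFunctor_map S'' s (ObjectProperty.trW_monotone h'' s hs)
  rw [← cancel_mono ((quotientFunctor S'').map s), ← quotientHomMap_postcomp,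
    ← quotientHomMap_postcomp, ← quotientHomMap_postcomp, hf]
  simp only [quotientHomMap_map]

variable (S) in
/-- The morphism `f` of the Verdier quotient `C / S` factors through (the image of) an object
satisfying `P`. -/
def FactorsThrough (P : ObjectProperty C) {Y X : C} (f : QuotientHom S Y X) : Prop :=
  ∃ (Z : C) (a : QuotientHom S Y Z) (b : QuotientHom S Z X), P Z ∧ a ≫ b = f

theorem FactorsThrough.precomp {P : ObjectProperty C} {Y X Y' : C} {f : QuotientHom S Y X}
    (hf : FactorsThrough S P f) (g : QuotientHom S Y' Y) :
    FactorsThrough S P (Y := Y') (X := X) (g ≫ f) := by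
  obtain ⟨Z, a, b, hZ, rfl⟩ := hf
  exact ⟨Z, g ≫ a, b, hZ, by simp⟩

theorem FactorsThrough.postcomp {P : ObjectProperty C} {Y X X' : C} {f : QuotientHom S Y X}
    (hf : FactorsThrough S P f) (g : QuotientHom S X X') :
    FactorsThrough S P (Y := Y) (X := X') (f ≫ g) := by
  obtain ⟨Z, a, b, hZ, rfl⟩ := hf
  exact ⟨Z, a, b ≫ g, hZ, by simp⟩

theorem factorsThrough_zero {P : ObjectProperty C} [P.ContainsZero] {Y X : C} :
    FactorsThrough S P (0 : QuotientHom S Y X) := by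
  obtain ⟨Z, -, hZ⟩ := P.exists_prop_of_containsZero
  exact ⟨Z, 0, 0, hZ, by simp⟩

theorem FactorsThrough.quotientHomMap_eq_zero {Y X : C} {f : QuotientHom S Y X}
    (hf : FactorsThrough S S' f) : quotientHomMap h Y X f = 0 := by
  obtain ⟨Z, a, b, hZ, rfl⟩ := hf
  rw [quotientHomMap_comp, quotientHom_eq_zero_left S' hZ (quotientHomMap h Z X b), comp_zero]

/-- The second factor is a genuine morphism of `C`: it can be completed to a triangle in `C`, and
naturality statements known only for morphisms of `C` apply to it. -/
theorem exists_comp_map_of_quotientHomMap_eq_zero {Y X : C} (f : QuotientHom S Y X)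
    (hf : quotientHomMap h Y X f = 0) :
    ∃ (Z : C) (a : QuotientHom S Y Z) (k : Z ⟶ X), S' Z ∧ a ≫ (quotientFunctor S).map k = f := by
  obtain ⟨Y', t, g, ht, hg⟩ := exists_map_comp_quotientHom_eq S f
  have := isIso_quotientFunctor_map S t ht
  obtain ⟨Z, a, k, hZ, rfl⟩ := exists_comp_eq_zero_of_map_eq_zero S' g (by
    rw [← quotientHomMap_map h, ← hg, quotientHomMap_precomp, hf, comp_zero])
  exact ⟨Z, inv ((quotientFunctor S).map t) ≫ (quotientFunctor S).map a, k, hZ, by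
    rw [Category.assoc, ← Functor.map_comp, ← hg, IsIso.inv_hom_id_assoc]⟩

theorem quotientHomMap_eq_zero_iff {Y X : C} (f : QuotientHom S Y X) :
    quotientHomMap h Y X f = 0 ↔ FactorsThrough S S' f := by
  refine ⟨fun hf => ?_, fun hf => hf.quotientHomMap_eq_zero h⟩
  obtain ⟨Z, a, k, hZ, hk⟩ := exists_comp_map_of_quotientHomMap_eq_zero h f hf
  exact ⟨Z, a, _, hZ, hk⟩

end

end Quotient

end TriangulatedMV

namespace TriangulatedMV

open Pretriangulated
open scoped ZeroObject

/-! ### Split objects and the boundary relation. -/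

section Splitting

variable {C : Type u} [Category.{v} C] [HasZeroObject C] [HasShift C ℤ] [Preadditive C]
  [∀ n : ℤ, (shiftFunctor C n).Additive] [Pretriangulated C] [IsTriangulated C]
  [EssentiallySmall.{v} C]

/-- The endomorphism `e` of `Z` in `C / W` factors through an object of `U`, and its complement
`1 - e` factors through an object of `V`. -/
structure IsSplitting (W U V : ObjectProperty C) [W.IsTriangulated] {Z : C}
    (e : QuotientHom W Z Z) : Prop where
  factors : FactorsThrough W U e
  factors_compl : FactorsThrough W V (𝟙 ((quotientFunctor W).obj Z) - e)

/-- In `C / W` there are no nonzero morphisms between `U` and `V`, and every object of `J` is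
split into a part in `U` and a part in `V`. -/
structure IsSplit (W U V J : ObjectProperty C) [W.IsTriangulated] : Prop where
  le_left : W ≤ U
  le_right : W ≤ V
  left_le : U ≤ J
  right_le : V ≤ J
  eq_zero_left_right : ∀ ⦃X Y : C⦄, U X → V Y → ∀ f : QuotientHom W X Y, f = 0
  eq_zero_right_left : ∀ ⦃X Y : C⦄, V X → U Y → ∀ f : QuotientHom W X Y, f = 0
  exists_isSplitting : ∀ ⦃Z : C⦄, J Z → ∃ e : QuotientHom W Z Z, IsSplitting W U V e

variable {W U V J : ObjectProperty C} [W.IsTriangulated]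

theorem IsSplitting.symm {Z : C} {e : QuotientHom W Z Z} (he : IsSplitting W U V e) :
    IsSplitting W V U (𝟙 ((quotientFunctor W).obj Z) - e) :=
  ⟨he.factors_compl, by simpa using he.factors⟩

theorem IsSplit.symm (H : IsSplit W U V J) : IsSplit W V U J where
  le_left := H.le_right
  le_right := H.le_left
  left_le := H.right_le
  right_le := H.left_le
  eq_zero_left_right := H.eq_zero_right_left
  eq_zero_right_left := H.eq_zero_left_right
  exists_isSplitting _ hZ := by
    obtain ⟨e, he⟩ := H.exists_isSplitting hZ
    exact ⟨_, he.symm⟩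

theorem isSplitting_id [V.ContainsZero] {Z : C} (hZ : U Z) :
    IsSplitting W U V (𝟙 ((quotientFunctor W).obj Z)) :=
  ⟨⟨Z, 𝟙 _, 𝟙 _, hZ, by simp⟩, by simpa using factorsThrough_zero⟩

theorem isSplitting_zero [U.ContainsZero] {Z : C} (hZ : V Z) : IsSplitting W U V (0 :
    QuotientHom W Z Z) :=
  ⟨factorsThrough_zero, ⟨Z, 𝟙 _, 𝟙 _, hZ, by simp⟩⟩

theorem IsSplit.comp_eq_zero (H : IsSplit W U V J) {X Y Z : C} {f : QuotientHom W X Y}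
    {g : QuotientHom W Y Z}
    (hf : FactorsThrough W U f) (hg : FactorsThrough W V g) : f ≫ g = 0 := by
  obtain ⟨A, a, b, hA, rfl⟩ := hf
  obtain ⟨B, c, d, hB, rfl⟩ := hg
  have h : b ≫ c = 0 := H.eq_zero_left_right hA hB _
  rw [Category.assoc, reassoc_of% h, zero_comp, comp_zero]

/-- Orthogonality gives `e f (1 - e') = 0` and `(1 - e) f e' = 0`, whence `e f = e f e' = f e'`. In
particular the splitting of an object is unique. -/
theorem IsSplit.naturality (H : IsSplit W U V J) {Z Z' : C} {e : QuotientHom W Z Z}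
    {e' : QuotientHom W Z' Z'}
    (he : IsSplitting W U V e) (he' : IsSplitting W U V e') (f : QuotientHom W Z Z') :
    e ≫ f = f ≫ e' := by
  have h₁ := H.comp_eq_zero (he.factors.postcomp f) he'.factors_compl
  have h₂ := H.symm.comp_eq_zero (he.factors_compl.postcomp f) he'.factors
  simp only [Preadditive.comp_sub, Preadditive.sub_comp, Category.comp_id, Category.id_comp,
    sub_eq_zero] at h₁ h₂
  exact h₁.trans h₂.symm

/-- The morphism `ψ : Y ⟶ X⟦1⟧` of `C / W` is a value of the connecting map at the morphism
`φ : Y ⟶ X` of `C / J`: if `φ` is the fraction of `f : Y ⟶ X'` and `s : X ⟶ X'`, then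
`ψ` is the composition of `f` with `X' ⟶ cone(s)`, with the projection of `cone(s)` to its part
in `U`, and with `cone(s) ⟶ X⟦1⟧`. -/
def IsBoundary (W U V J : ObjectProperty C) [W.IsTriangulated] [J.IsTriangulated] (hWJ : W ≤ J)
    {Y X : C} (φ : QuotientHom J Y X) (ψ : QuotientHom W Y (X⟦(1 : ℤ)⟧)) : Prop :=
  ∃ (X' Z : C) (s : X ⟶ X') (h : X' ⟶ Z) (k : Z ⟶ X⟦(1 : ℤ)⟧) (e : QuotientHom W Z Z)
    (f : QuotientHom W Y X'), Triangle.mk s h k ∈ distTriang C ∧ J Z ∧ IsSplitting W U V e ∧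
      φ ≫ (quotientFunctor J).map s = quotientHomMap hWJ Y X' f ∧
      f ≫ (quotientFunctor W).map h ≫ e ≫ (quotientFunctor W).map k = ψ

namespace IsSplit

/-- The fill-in `c : Z ⟶ Z₁` between cones is not unique, but any choice commutes with the
projections `e`, `e₁` by `naturality`. -/
theorem boundary_postcomp (H : IsSplit W U V J) {Y X X' Z X₁ X₁' Z₁ : C} {s : X ⟶ X'} {h : X' ⟶ Z}
    {k : Z ⟶ X⟦(1 : ℤ)⟧} (hT : Triangle.mk s h k ∈ distTriang C)
    {s₁ : X₁ ⟶ X₁'} {h₁ : X₁' ⟶ Z₁} {k₁ : Z₁ ⟶ X₁⟦(1 : ℤ)⟧}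
    (hT₁ : Triangle.mk s₁ h₁ k₁ ∈ distTriang C) {e : QuotientHom W Z Z}
    (he : IsSplitting W U V e) {e₁ : QuotientHom W Z₁ Z₁} (he₁ : IsSplitting W U V e₁)
    (a : X ⟶ X₁) (a' : X' ⟶ X₁') (fac : s ≫ a' = a ≫ s₁) (f : QuotientHom W Y X') :
    (f ≫ (quotientFunctor W).map a') ≫ (quotientFunctor W).map h₁ ≫ e₁ ≫
      (quotientFunctor W).map k₁ =
    (f ≫ (quotientFunctor W).map h ≫ e ≫ (quotientFunctor W).map k) ≫
      (quotientFunctor W).map (a⟦(1 : ℤ)⟧') := by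
  obtain ⟨(c : Z ⟶ Z₁), (hc : h ≫ c = a' ≫ h₁), (hc' : k ≫ a⟦(1 : ℤ)⟧' = c ≫ k₁)⟩ :=
    complete_distinguished_triangle_morphism _ _ hT hT₁ a a' fac
  simp only [Category.assoc, ← Functor.map_comp, hc']
  rw [← Functor.map_comp_assoc, ← hc, Functor.map_comp_assoc, Functor.map_comp]
  have := H.naturality he he₁ ((quotientFunctor W).map c)
  rw [reassoc_of% this]

variable [J.IsTriangulated]

variable (hWJ : W ≤ J)

theorem exists_isBoundary (H : IsSplit W U V J) {Y X : C} (φ : QuotientHom J Y X) :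
    ∃ ψ, IsBoundary W U V J hWJ φ ψ := by
  obtain ⟨X', s, g, ⟨Z, h, k, hT, hZ⟩, hg⟩ := exists_quotientHom_comp_map_eq J φ
  obtain ⟨e, he⟩ := H.exists_isSplitting hZ
  exact ⟨_, X', Z, s, h, k, e, (quotientFunctor W).map g, hT, hZ, he,
    by rw [hg, quotientHomMap_map], rfl⟩

theorem isBoundary_postcomp (H : IsSplit W U V J) {Y X X₁ : C} {φ : QuotientHom J Y X}
    {ψ : QuotientHom W Y (X⟦(1 : ℤ)⟧)} (hφ : IsBoundary W U V J hWJ φ ψ) (a : X ⟶ X₁) :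
    IsBoundary W U V J hWJ (Y := Y) (X := X₁) (φ ≫ (quotientFunctor J).map a)
      (ψ ≫ (quotientFunctor W).map (a⟦(1 : ℤ)⟧')) := by
  obtain ⟨X', Z, s, h, k, e, f, hT, hZ, he, hf, rfl⟩ := hφ
  -- The Ore condition completes `s` and `a` to a square whose side out of `X₁` is again a
  -- denominator.
  obtain ⟨α, hα⟩ := (MorphismProperty.RightFraction.mk (W := J.trW) s
    ⟨Z, h, k, hT, hZ⟩ a).exists_leftFraction
  obtain ⟨Z₁, h₁, k₁, hT₁, hZ₁⟩ := α.hs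
  obtain ⟨e₁, he₁⟩ := H.exists_isSplitting hZ₁
  refine ⟨_, Z₁, α.s, h₁, k₁, e₁, f ≫ (quotientFunctor W).map α.f, hT₁, hZ₁, he₁, ?_,
    H.boundary_postcomp hT hT₁ he he₁ a α.f hα.symm f⟩
  dsimp at hα
  rw [quotientHomMap_postcomp, ← hf, Category.assoc, Category.assoc, ← Functor.map_comp,
    ← Functor.map_comp, hα]

/-- Both fractions are brought to a common denominator; `boundary_postcomp` along `𝟙 X` shows that
this leaves their boundaries unchanged. -/
theorem isBoundary_sub (H : IsSplit W U V J) {Y X : C} {φ φ' : QuotientHom J Y X}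
    {ψ ψ' : QuotientHom W Y (X⟦(1 : ℤ)⟧)} (hφ : IsBoundary W U V J hWJ φ ψ)
    (hφ' : IsBoundary W U V J hWJ φ' ψ') : IsBoundary W U V J hWJ (φ - φ') (ψ - ψ') := by
  obtain ⟨X₁, Z₁, s₁, h₁, k₁, e₁, f₁, hT₁, hZ₁, he₁, hf₁, rfl⟩ := hφ
  obtain ⟨X₂, Z₂, s₂, h₂, k₂, e₂, f₂, hT₂, hZ₂, he₂, hf₂, rfl⟩ := hφ'
  obtain ⟨α, hα⟩ := (MorphismProperty.RightFraction.mk (W := J.trW) s₁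
    ⟨Z₁, h₁, k₁, hT₁, hZ₁⟩ s₂).exists_leftFraction
  dsimp at hα
  obtain ⟨Z, h, k, hT, hZ⟩ := J.trW.comp_mem _ _ ⟨Z₂, h₂, k₂, hT₂, hZ₂⟩ α.hs
  obtain ⟨e, he⟩ := H.exists_isSplitting hZ
  have E₁ := H.boundary_postcomp hT₁ hT he₁ he (𝟙 X) α.f (by rw [← hα, Category.id_comp]) f₁
  have E₂ := H.boundary_postcomp hT₂ hT he₂ he (𝟙 X) α.s (by rw [Category.id_comp]) f₂
  rw [CategoryTheory.Functor.map_id, CategoryTheory.Functor.map_id, Category.comp_id] at E₁ E₂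
  refine ⟨_, Z, _, h, k, e, f₁ ≫ (quotientFunctor W).map α.f -
    f₂ ≫ (quotientFunctor W).map α.s, hT, hZ, he, ?_, ?_⟩
  · rw [map_sub, quotientHomMap_postcomp, quotientHomMap_postcomp, ← hf₁, ← hf₂,
      Preadditive.sub_comp, Category.assoc, Category.assoc, ← Functor.map_comp,
      ← Functor.map_comp, hα]
  · rw [Preadditive.sub_comp, E₁, E₂]

/-- If `f` dies in `C / J`, it factors through some `D` in `J`. Naturality moves the projection from
the cone back to `D`, and then the consecutive maps `h` and `k` compose to zero. -/
theorem eq_zero_of_isBoundary_zero (H : IsSplit W U V J) {Y X : C}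
    {ψ : QuotientHom W Y (X⟦(1 : ℤ)⟧)}
    (hψ : IsBoundary W U V J hWJ 0 ψ) : ψ = 0 := by
  obtain ⟨X', Z, s, h, k, e, f, hT, hZ, he, hf, rfl⟩ := hψ
  rw [zero_comp, eq_comm, quotientHomMap_eq_zero_iff] at hf
  obtain ⟨D, a, b, hD, rfl⟩ := hf
  obtain ⟨d, hd⟩ := H.exists_isSplitting hD
  have E := H.naturality hd he (b ≫ (quotientFunctor W).map h)
  have hk := map_comp_map_eq_zero_of_distTriang' W hT
  rw [Category.assoc] at E
  rw [Category.assoc, ← reassoc_of% E, hk]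
  simp

theorem isBoundary_unique (H : IsSplit W U V J) {Y X : C} {φ : QuotientHom J Y X}
    {ψ ψ' : QuotientHom W Y (X⟦(1 : ℤ)⟧)}
    (h : IsBoundary W U V J hWJ φ ψ) (h' : IsBoundary W U V J hWJ φ ψ') : ψ = ψ' :=
  sub_eq_zero.1 (H.eq_zero_of_isBoundary_zero hWJ (by
    simpa using H.isBoundary_sub hWJ h h'))

theorem _root_.TriangulatedMV.isBoundary_precomp
    {Y Y' X : C} {φ : QuotientHom J Y X}
    {ψ : QuotientHom W Y (X⟦(1 : ℤ)⟧)} (hφ : IsBoundary W U V J hWJ φ ψ) (b : Y' ⟶ Y) :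
    IsBoundary W U V J hWJ (Y := Y') (X := X) ((quotientFunctor J).map b ≫ φ)
      ((quotientFunctor W).map b ≫ ψ) := by
  obtain ⟨X', Z, s, h, k, e, f, hT, hZ, he, hf, rfl⟩ := hφ
  exact ⟨X', Z, s, h, k, e, (quotientFunctor W).map b ≫ f, hT, hZ, he,
    by rw [quotientHomMap_precomp, ← hf, Category.assoc], by rw [Category.assoc]⟩

end IsSplit

end Splitting

end TriangulatedMV

namespace TriangulatedMV

open Pretriangulated
open scoped ZeroObject

/-! ### Exactness of the Mayer–Vietoris sequence in the split situation. -/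

section Exactness

variable {C : Type u} [Category.{v} C] [HasZeroObject C] [HasShift C ℤ] [Preadditive C]
  [∀ n : ℤ, (shiftFunctor C n).Additive] [Pretriangulated C] [IsTriangulated C]
  [EssentiallySmall.{v} C]
  {W U V J : ObjectProperty C} [W.IsTriangulated] [U.IsTriangulated] [J.IsTriangulated]

namespace IsSplit

/-- Write `α` as a fraction of `g` and `s`. In `C / W` the numerator `g` factors through some `D` in
`J`. Its `U`-part is invisible in `C / U`; its `V`-part has zero composite to the cone of `s`, which
lies in `U`, so it lifts along `s`. -/
theorem exists_lift_factorsThrough_right (H : IsSplit W U V J) {Y X : C} (α : QuotientHom U Y X)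
    (hα : quotientHomMap H.left_le Y X α = 0) :
    ∃ γ : QuotientHom W Y X, FactorsThrough W V γ ∧ quotientHomMap H.le_left Y X γ = α := by
  obtain ⟨X₁, s, g, ⟨u, h, k, hT, hu⟩, hg⟩ := exists_quotientHom_comp_map_eq U α
  have := isIso_quotientFunctor_map U s ⟨u, h, k, hT, hu⟩
  obtain ⟨D, a, i, hD, hai⟩ := exists_comp_map_of_quotientHomMap_eq_zero
    (H.le_left.trans H.left_le) ((quotientFunctor W).map g) (by
      rw [quotientHomMap_map, ← quotientHomMap_map H.left_le, ← hg, quotientHomMap_postcomp, hα,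
        zero_comp])
  obtain ⟨e, he⟩ := H.exists_isSplitting hD
  obtain ⟨v, x, y, hv, hxy⟩ := he.factors_compl
  obtain ⟨y', hy'⟩ := exists_lift_of_distTriang W hT (y ≫ (quotientFunctor W).map i)
    (H.eq_zero_right_left hv hu _)
  refine ⟨a ≫ x ≫ y', ⟨v, a ≫ x, y', hv, by simp⟩, ?_⟩
  have hp := quotientHomMap_comp H.le_left e ((quotientFunctor W).map i)
  rw [he.factors.quotientHomMap_eq_zero H.le_left, zero_comp] at hp
  rw [← cancel_mono ((quotientFunctor U).map s), ← quotientHomMap_postcomp, hg,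
    ← quotientHomMap_map H.le_left g, ← hai]
  simp only [Category.assoc]
  rw [hy', reassoc_of% hxy, Preadditive.sub_comp, Category.id_comp, quotientHomMap_comp, map_sub,
    hp, sub_zero, ← quotientHomMap_comp]

variable [V.IsTriangulated]

theorem exists_lift_left (H : IsSplit W U V J) {Y X : C} (α : QuotientHom U Y X)
    (β : QuotientHom V Y X)
    (hαβ : quotientHomMap H.left_le Y X α = quotientHomMap H.right_le Y X β) :
    ∃ γ : QuotientHom W Y X, quotientHomMap H.le_left Y X γ = α := by
  obtain ⟨X₁, s, g, ⟨u, h, k, hT, hu⟩, hg⟩ := exists_quotientHom_comp_map_eq U α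
  have := isIso_quotientFunctor_map U s ⟨u, h, k, hT, hu⟩
  -- The numerator `g` is corrected by a morphism through `U`, so that in `C / V` it becomes `β`
  -- followed by `s`, without changing in `C / U`.
  obtain ⟨γ₁, hγ₁, hγ₁'⟩ := H.symm.exists_lift_factorsThrough_right
    (β ≫ (quotientFunctor V).map s - (quotientFunctor V).map g) (by
      rw [map_sub, quotientHomMap_postcomp, ← hαβ, ← quotientHomMap_postcomp, hg,
        quotientHomMap_map, quotientHomMap_map, sub_self])
  have hs := map_comp_map_eq_zero_of_distTriang V hT
  let f : QuotientHom W Y X₁ := (quotientFunctor W).map g + γ₁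
  have hf : quotientHomMap H.le_right Y u (f ≫ (quotientFunctor W).map h) = 0 := by
    rw [quotientHomMap_postcomp, map_add, hγ₁', quotientHomMap_map, add_sub_cancel,
      Category.assoc, hs, comp_zero]
  -- The obstruction to lifting `f` along `s` factors through `V` and ends in `u`, hence vanishes.
  rw [quotientHomMap_eq_zero_iff] at hf
  obtain ⟨v, a, b, hv, hab⟩ := hf
  obtain rfl := H.eq_zero_right_left hv hu b
  rw [comp_zero] at hab
  obtain ⟨γ, hγ⟩ := exists_lift_of_distTriang W hT f hab.symm
  refine ⟨γ, ?_⟩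
  rw [← cancel_mono ((quotientFunctor U).map s), ← quotientHomMap_postcomp, hg, hγ, map_add,
    hγ₁.quotientHomMap_eq_zero, add_zero, quotientHomMap_map]

theorem exists_lift (H : IsSplit W U V J) {Y X : C} (α : QuotientHom U Y X)
    (β : QuotientHom V Y X)
    (hαβ : quotientHomMap H.left_le Y X α = quotientHomMap H.right_le Y X β) :
    ∃ γ : QuotientHom W Y X, quotientHomMap H.le_left Y X γ = α ∧
      quotientHomMap H.le_right Y X γ = β := by
  obtain ⟨γ, rfl⟩ := H.exists_lift_left α β hαβ
  -- The remaining error in `C / V` is lifted to a morphism through `U`, which adding to `γ` does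
  -- not change in `C / U`.
  obtain ⟨γ', hγ', h⟩ := H.symm.exists_lift_factorsThrough_right
    (β - quotientHomMap H.le_right Y X γ) (by
      rw [map_sub, ← hαβ,
        quotientHomMap_quotientHomMap _ H.left_le (H.le_left.trans H.left_le),
        quotientHomMap_quotientHomMap _ H.right_le (H.le_left.trans H.left_le), sub_self])
  exact ⟨γ + γ', by rw [map_add, hγ'.quotientHomMap_eq_zero, add_zero],
    by rw [map_add, h, add_sub_cancel]⟩

variable (hWJ : W ≤ J)

/-- The cone of a denominator from `C / U` lies in `U`, so its projection is the identity and the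
boundary contains `h ≫ k`. -/
theorem isBoundary_left (H : IsSplit W U V J) {Y X : C} (α : QuotientHom U Y X) :
    IsBoundary W U V J hWJ (quotientHomMap H.left_le Y X α) 0 := by
  obtain ⟨X₁, s, g, ⟨u, h, k, hT, hu⟩, hg⟩ := exists_quotientHom_comp_map_eq U α
  refine ⟨X₁, u, s, h, k, 𝟙 _, (quotientFunctor W).map g, hT, H.left_le _ hu,
    isSplitting_id hu, ?_, ?_⟩
  · rw [← quotientHomMap_postcomp, hg, quotientHomMap_map, quotientHomMap_map]
  · have hk := map_comp_map_eq_zero_of_distTriang' W hT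
    rw [Category.id_comp, hk, comp_zero]

theorem isBoundary_right (H : IsSplit W U V J) {Y X : C} (β : QuotientHom V Y X) :
    IsBoundary W U V J hWJ (quotientHomMap H.right_le Y X β) 0 := by
  obtain ⟨X₁, s, g, ⟨z, h, k, hT, hz⟩, hg⟩ := exists_quotientHom_comp_map_eq V β
  refine ⟨X₁, z, s, h, k, 0, (quotientFunctor W).map g, hT, H.right_le _ hz,
    isSplitting_zero hz, ?_, by simp⟩
  rw [← quotientHomMap_postcomp, hg, quotientHomMap_map, quotientHomMap_map]

theorem isBoundary_zero_iff (H : IsSplit W U V J) {Y X : C} (φ : QuotientHom J Y X) :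
    IsBoundary W U V J hWJ φ 0 ↔ ∃ (α : QuotientHom U Y X) (β : QuotientHom V Y X),
      quotientHomMap H.left_le Y X α - quotientHomMap H.right_le Y X β = φ := by
  constructor
  · rintro ⟨X', Z, s, h, k, e, f, hT, hZ, he, hf, h0⟩
    -- `f` is decomposed as `f₁ + (f - f₁)`: the first term lifts along `s` in `C / U`, where `e`
    -- dies, the second in `C / V`, where `1 - e` dies.
    obtain ⟨f₁, hf₁⟩ := exists_lift_of_distTriang' W hT
      (f ≫ (quotientFunctor W).map h ≫ e) (by simpa only [Category.assoc] using h0)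
    have hα := ((he.factors.precomp ((quotientFunctor W).map h)).precomp
      f).quotientHomMap_eq_zero H.le_left
    have hβ := ((he.factors_compl.precomp ((quotientFunctor W).map h)).precomp
      f).quotientHomMap_eq_zero H.le_right
    rw [← hf₁, quotientHomMap_postcomp] at hα
    rw [Preadditive.comp_sub, Category.comp_id, Preadditive.comp_sub, ← hf₁,
      ← Preadditive.sub_comp, quotientHomMap_postcomp] at hβ
    obtain ⟨α, hα⟩ := exists_lift_of_distTriang U hT _ hα
    obtain ⟨β, hβ⟩ := exists_lift_of_distTriang V hT _ hβ
    have := isIso_quotientFunctor_map J s ⟨Z, h, k, hT, hZ⟩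
    refine ⟨α, -β, ?_⟩
    rw [← cancel_mono ((quotientFunctor J).map s), map_neg, sub_neg_eq_add, Preadditive.add_comp,
      ← quotientHomMap_postcomp, ← quotientHomMap_postcomp, hα, hβ,
      quotientHomMap_quotientHomMap _ _ hWJ, quotientHomMap_quotientHomMap _ _ hWJ, hf, map_sub,
      add_sub_cancel]
  · rintro ⟨α, β, rfl⟩
    simpa using H.isBoundary_sub hWJ (H.isBoundary_left hWJ α) (H.isBoundary_right hWJ β)

theorem exists_isBoundary_iff [J.IsClosedUnderIsomorphisms] (H : IsSplit W U V J) {Y X : C}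
    (ψ : QuotientHom W Y (X⟦(1 : ℤ)⟧)) :
    (∃ φ, IsBoundary W U V J hWJ φ ψ) ↔
      quotientHomMap H.le_left _ _ ψ = 0 ∧ quotientHomMap H.le_right _ _ ψ = 0 := by
  constructor
  · rintro ⟨φ, X', Z, s, h, k, e, f, hT, hZ, he, hf, rfl⟩
    refine ⟨(((he.factors.postcomp _).precomp _).precomp _).quotientHomMap_eq_zero H.le_left, ?_⟩
    have hk := map_comp_map_eq_zero_of_distTriang' W hT
    -- Since `h ≫ k` vanishes, replacing `e` by `1 - e` only changes the sign of the boundary.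
    have := (((he.factors_compl.postcomp ((quotientFunctor W).map k)).precomp
      ((quotientFunctor W).map h)).precomp f).quotientHomMap_eq_zero H.le_right
    simpa [hk, Preadditive.sub_comp, Preadditive.comp_sub] using this
  · rintro ⟨hU, hV⟩
    obtain ⟨u, a, k, hu, ha⟩ := exists_comp_map_of_quotientHomMap_eq_zero H.le_left ψ hU
    obtain ⟨z, b, l, hz, hb⟩ := exists_comp_map_of_quotientHomMap_eq_zero H.le_right ψ hV
    -- The triangle is built from its cone `u ⊞ z`. The sign makes the pair `(a, b)` compose to `ψ -
    -- ψ = 0`, so it lifts to `X'`; projecting to `u` then gives back `ψ`.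
    obtain ⟨X', s, h, hT⟩ := distinguished_cocone_triangle₂ (biprod.desc k (-l))
    let p : QuotientHom W (u ⊞ z) (u ⊞ z) := (quotientFunctor W).map (biprod.fst ≫ biprod.inl)
    have hp : IsSplitting W U V p := by
      refine ⟨⟨u, (quotientFunctor W).map biprod.fst, (quotientFunctor W).map biprod.inl, hu,
        ((quotientFunctor W).map_comp _ _).symm⟩,
        ⟨z, (quotientFunctor W).map biprod.snd, (quotientFunctor W).map biprod.inr, hz, ?_⟩⟩
      rw [eq_sub_iff_add_eq, ← Functor.map_comp, ← Functor.map_add, add_comm, biprod.total,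
        CategoryTheory.Functor.map_id]
    let c : QuotientHom W Y (u ⊞ z) := a ≫ (quotientFunctor W).map biprod.inl +
      b ≫ (quotientFunctor W).map biprod.inr
    obtain ⟨f, hf⟩ := exists_lift_of_distTriang' W hT c (by
      rw [Preadditive.add_comp, Category.assoc, Category.assoc, ← Functor.map_comp,
        ← Functor.map_comp, biprod.inl_desc, biprod.inr_desc, Functor.map_neg,
        Preadditive.comp_neg, ha, hb, add_neg_cancel])
    have hJ : J (u ⊞ z) := J.ext_of_isTriangulatedClosed₂ _
      (binaryBiproductTriangle_distinguished u z) (H.left_le _ hu) (H.right_le _ hz)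
    have := isIso_quotientFunctor_map J s ⟨_, _, _, hT, hJ⟩
    refine ⟨quotientHomMap hWJ Y X' f ≫ inv ((quotientFunctor J).map s), X', u ⊞ z, s, h, _, p, f,
      hT, hJ, hp, by simp, ?_⟩
    rw [reassoc_of% hf, Preadditive.add_comp, Category.assoc, Category.assoc, ← Functor.map_comp,
      ← Functor.map_comp, ← Functor.map_comp]
    simp [ha]

end IsSplit

end Exactness

end TriangulatedMV

namespace TriangulatedMV

open Pretriangulated

/-! ### Commuting subcategories give split situations. -/

section Commuting

variable {C : Type u} [Category.{v} C] [HasZeroObject C] [HasShift C ℤ] [Preadditive C]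
  [∀ n : ℤ, (shiftFunctor C n).Additive] [Pretriangulated C] [IsTriangulated C]
  {U V : ObjectProperty C} [U.IsTriangulated] [V.IsTriangulated]

open ObjectProperty

/-- The connecting map `u ⟶ v⟦1⟧` of the extension factors through some `w` in `U ∧ V`. The
octahedral axiom presents its cone `Z⟦1⟧` as an extension of the cones of `u ⟶ w` and `w ⟶ v⟦1⟧`,
which lie in `U` and `V`. -/
theorem Commuting.extensionProduct_le (h : Commuting U V) :
    extensionProduct V U ≤ extensionProduct U V := by
  rintro Z ⟨v, u, f, g, k, hT, hv, hu⟩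
  obtain ⟨w, a, b, hw, rfl⟩ := h.1 k hu (V.le_shift 1 _ hv)
  obtain ⟨A, hA, a', a'', hTa⟩ := U.distinguished_cocone_triangle a hu hw.1
  obtain ⟨B, hB, b', b'', hTb⟩ := V.distinguished_cocone_triangle b hw.2 (V.le_shift 1 _ hv)
  have := (extensionProduct U V).prop_shift_iff_of_isStableUnderShift Z (1 : ℤ)
  exact this.1 ⟨_, _, _, _, _, (Triangulated.someOctahedron rfl hTa hTb
    (rot_of_distTriang _ (rot_of_distTriang _ hT))).mem, hA, hB⟩

variable [U.IsStableUnderRetracts] [V.IsStableUnderRetracts]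

theorem Commuting.extensionProduct_extensionProduct_le (h : Commuting U V) :
    extensionProduct (extensionProduct U V) (extensionProduct U V) ≤ extensionProduct U V :=
  calc
    _ = extensionProduct U (extensionProduct (extensionProduct V U) V) := by
      simp only [extensionProduct_assoc]
    _ ≤ extensionProduct U (extensionProduct (extensionProduct U V) V) :=
      monotone_extensionProduct_right _ (monotone_extensionProduct_left _ h.extensionProduct_le)
    _ = extensionProduct (extensionProduct U U) (extensionProduct V V) := by
      simp only [extensionProduct_assoc]
    _ ≤ extensionProduct U (extensionProduct V V) := monotone_extensionProduct_left _
      (extensionProduct_le_of_isTriangulatedClosed₂ le_rfl le_rfl)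
    _ ≤ extensionProduct U V := monotone_extensionProduct_right _
      (extensionProduct_le_of_isTriangulatedClosed₂ le_rfl le_rfl)

/-- `U * V` is closed under extensions, and so is its retract closure, which is therefore a thick
subcategory containing `U` and `V`. -/
theorem Commuting.thickJoin_le (h : Commuting U V) :
    thickJoin U V ≤ (extensionProduct U V).retractClosure := by
  have hU : U ≤ (extensionProduct U V).retractClosure :=
    (le_extensionProduct_left _).trans (le_retractClosure _)
  have hV : V ≤ (extensionProduct U V).retractClosure :=
    (le_extensionProduct_right _).trans (le_retractClosure _)
  have : (extensionProduct U V).retractClosure.IsTriangulatedClosed₂ :=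
    .mk' fun T hT h₁ h₃ => monotone_retractClosure h.extensionProduct_extensionProduct_le _
      (extensionProduct_retractClosure_retractClosure_le _ _ _
        ⟨_, _, _, _, _, hT, h₁, h₃⟩)
  obtain ⟨Z, hZ, hZ'⟩ := U.exists_prop_of_containsZero
  have : (extensionProduct U V).retractClosure.ContainsZero := ⟨⟨Z, hZ, hU _ hZ'⟩⟩
  have : (extensionProduct U V).retractClosure.IsTriangulated := { }
  exact (triangEnvelope_le_iff _).2 (sup_le hU hV)

variable [EssentiallySmall.{v} C]

/-- The denominator has cone in `W ≤ Q`, so the numerator still ends in `Q` and itself factors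
through `W`. -/
theorem quotientHom_eq_zero_of_factorization {P Q W : ObjectProperty C} [W.IsTriangulated]
    [Q.IsTriangulated] [Q.IsClosedUnderIsomorphisms] (hWQ : W ≤ Q)
    (h : ∀ ⦃X Y : C⦄ (f : X ⟶ Y), P X → Q Y →
      ∃ (Z : C) (g : X ⟶ Z) (h : Z ⟶ Y), W Z ∧ g ≫ h = f)
    {X Y : C} (hX : P X) (hY : Q Y) (f : QuotientHom W X Y) : f = 0 := by
  obtain ⟨Y', s, g, ⟨Z, a, b, hT, hZ⟩, hg⟩ := exists_quotientHom_comp_map_eq W f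
  have := isIso_quotientFunctor_map W s ⟨Z, a, b, hT, hZ⟩
  obtain ⟨w, c, d, hw, rfl⟩ := h g hX (Q.ext_of_isTriangulatedClosed₂ _ hT hY (hWQ _ hZ))
  rw [← cancel_mono ((quotientFunctor W).map s), hg, Functor.map_comp,
    quotientHom_eq_zero_left W hw ((quotientFunctor W).map d), comp_zero, zero_comp]

theorem Commuting.isSplit (h : Commuting U V) : IsSplit (U ⊓ V) U V (thickJoin U V) where
  le_left := inf_le_left
  le_right := inf_le_right
  left_le := left_le_thickJoin U V
  right_le := right_le_thickJoin U V
  eq_zero_left_right _ _ hX hY := quotientHom_eq_zero_of_factorization inf_le_right h.1 hX hY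
  eq_zero_right_left _ _ hX hY := quotientHom_eq_zero_of_factorization inf_le_left h.2 hX hY
  exists_isSplitting Z hZ := by
    obtain ⟨Z', ⟨u, v, f, g, k, hT, hu, hv⟩, ⟨r⟩⟩ := h.thickJoin_le _ hZ
    obtain ⟨w, a, b, hw, hab⟩ := h.2 k hv (U.le_shift 1 _ hu)
    -- The connecting map vanishes in `C / (U ∧ V)`, so `g` has a section `t` there and `1 - g t`
    -- factors through `u`. Conjugating by the retraction gives `e` on `Z`.
    obtain ⟨t, ht⟩ := exists_lift_of_distTriang' (U ⊓ V) hT (𝟙 _) (by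
      rw [← hab, Functor.map_comp,
        quotientHom_eq_zero_left (U ⊓ V) hw ((quotientFunctor (U ⊓ V)).map b), comp_zero,
        comp_zero])
    obtain ⟨l, hl⟩ := exists_lift_of_distTriang (U ⊓ V) hT
      (𝟙 _ - (quotientFunctor (U ⊓ V)).map g ≫ t) (by
        rw [Preadditive.sub_comp, Category.assoc, ht, Category.comp_id, Category.id_comp,
          sub_self])
    have hr : (quotientFunctor (U ⊓ V)).map r.i ≫ (quotientFunctor (U ⊓ V)).map r.r = 𝟙 _ := by
      rw [← Functor.map_comp, r.retract, CategoryTheory.Functor.map_id]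
    refine ⟨(quotientFunctor (U ⊓ V)).map r.i ≫ (l ≫ (quotientFunctor (U ⊓ V)).map f) ≫
      (quotientFunctor (U ⊓ V)).map r.r, ⟨u, (quotientFunctor (U ⊓ V)).map r.i ≫ l,
        (quotientFunctor (U ⊓ V)).map f ≫ (quotientFunctor (U ⊓ V)).map r.r, hu, by simp⟩,
      ⟨v, (quotientFunctor (U ⊓ V)).map r.i ≫ (quotientFunctor (U ⊓ V)).map g,
        t ≫ (quotientFunctor (U ⊓ V)).map r.r, hv, ?_⟩⟩
    rw [hl, Preadditive.sub_comp, Preadditive.comp_sub, Category.id_comp, hr]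
    simp

end Commuting

/-! ### The connecting homomorphism. -/

section Boundary

variable {C : Type u} [Category.{v} C] [HasZeroObject C] [HasShift C ℤ] [Preadditive C]
  [∀ n : ℤ, (shiftFunctor C n).Additive] [Pretriangulated C] [IsTriangulated C]
  [EssentiallySmall.{v} C] {W U V J : ObjectProperty C} [W.IsTriangulated] [J.IsTriangulated]

namespace IsSplit

/-- The connecting map `Hom_{C / J}(Y, X) → Hom_{C / W}(Y, X⟦1⟧)`. -/
noncomputable def boundary (H : IsSplit W U V J) (Y X : C) :
    QuotientHom J Y X →+ QuotientHom W Y (X⟦(1 : ℤ)⟧) :=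
  AddMonoidHom.ofMapSub (fun φ => (H.exists_isBoundary (H.le_left.trans H.left_le) φ).choose)
    fun _ _ => H.isBoundary_unique _ (Exists.choose_spec _)
      (H.isBoundary_sub _ (Exists.choose_spec _) (Exists.choose_spec _))

theorem boundary_eq_iff (H : IsSplit W U V J) {Y X : C} (φ : QuotientHom J Y X)
    (ψ : QuotientHom W Y (X⟦(1 : ℤ)⟧)) :
    H.boundary Y X φ = ψ ↔ IsBoundary W U V J (H.le_left.trans H.left_le) φ ψ := by
  have h := (H.exists_isBoundary (H.le_left.trans H.left_le) φ).choose_spec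
  exact ⟨fun e => e ▸ h, fun h' => H.isBoundary_unique _ h h'⟩

/-- The connecting maps `Hom_{C / J}(Y, X) → Hom_{C / W}(Y, X⟦1⟧)`, as a natural
transformation. -/
noncomputable def boundaryNat (H : IsSplit W U V J) :
    quotientYoneda J ⟶ shiftFunctor C (1 : ℤ) ⋙ quotientYoneda W where
  app X :=
    { app := fun Y => AddCommGrpCat.ofHom (H.boundary Y.unop X)
      naturality := fun Y Z b => by
        ext φ
        exact (H.boundary_eq_iff _ _).2 (isBoundary_precomp _
          ((H.boundary_eq_iff φ _).1 rfl) b.unop) }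
  naturality X X' a := by
    ext Y φ
    exact (H.boundary_eq_iff _ _).2 (H.isBoundary_postcomp _
      ((H.boundary_eq_iff (show QuotientHom J Y.unop X from φ) _).1 rfl) a)

end IsSplit

end Boundary

/-! ### The long exact sequence of morphism groups. -/

section HomSequence

variable {C : Type u} [Category.{v} C] [HasZeroObject C] [HasShift C ℤ] [Preadditive C]
  [∀ n : ℤ, (shiftFunctor C n).Additive] [Pretriangulated C] [IsTriangulated C]
  [EssentiallySmall.{v} C] {U V : ObjectProperty C} [U.IsTriangulated] [V.IsTriangulated]

theorem factorsThrough_comp_iso_iff {W P : ObjectProperty C} [W.IsTriangulated] {Y X X' : C}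
    (f : QuotientHom W Y X) (i : (quotientFunctor W).obj X ≅ (quotientFunctor W).obj X') :
    FactorsThrough W P (Y := Y) (X := X') (f ≫ i.hom) ↔ FactorsThrough W P f :=
  ⟨fun h => by simpa using h.postcomp i.inv, fun h => h.postcomp i.hom⟩

theorem homFromSum_apply [V.IsStableUnderRetracts] (Y X : C)
    (p : QuotientHom U Y X × QuotientHom V Y X) :
    homFromSum U V Y X p = quotientHomMap (left_le_thickJoin U V) Y X p.1 -
      quotientHomMap (right_le_thickJoin U V) Y X p.2 := by
  simp [homFromSum, sub_eq_add_neg]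

theorem homToSum_eq_zero_iff [U.IsStableUnderRetracts] (Y X : C) (f : QuotientHom (U ⊓ V) Y X) :
    homToSum U V Y X f = 0 ↔ quotientHomMap (inf_le_left : U ⊓ V ≤ U) Y X f = 0 ∧
      quotientHomMap (inf_le_right : U ⊓ V ≤ V) Y X f = 0 :=
  Prod.ext_iff

variable [U.IsStableUnderRetracts] [V.IsStableUnderRetracts]

theorem Commuting.exact_homToSum_homFromSum (h : Commuting U V) (Y X : C) :
    Function.Exact (homToSum U V Y X) (homFromSum U V Y X) := by
  rintro ⟨α, β⟩
  rw [homFromSum_apply, sub_eq_zero]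
  constructor
  · intro hαβ
    obtain ⟨γ, h₁, h₂⟩ := h.isSplit.exists_lift α β hαβ
    exact ⟨γ, Prod.ext h₁ h₂⟩
  · rintro ⟨γ, hγ⟩
    obtain ⟨rfl, rfl⟩ := Prod.ext_iff.1 hγ
    exact (quotientHomMap_quotientHomMap _ _ (inf_le_left.trans (left_le_thickJoin U V)) _).trans
      (quotientHomMap_quotientHomMap _ _ _ _).symm

theorem Commuting.exact_homFromSum_boundary (h : Commuting U V) (Y X : C) :
    Function.Exact (homFromSum U V Y X) (h.isSplit.boundary Y X) := by
  intro φ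
  rw [h.isSplit.boundary_eq_iff, h.isSplit.isBoundary_zero_iff]
  simp only [Set.mem_range, Prod.exists, homFromSum_apply]

theorem Commuting.exact_boundary_homToSum (h : Commuting U V) (Y X : C) :
    Function.Exact (h.isSplit.boundary Y X) (homToSum U V Y (X⟦(1 : ℤ)⟧)) := by
  intro ψ
  simp only [Set.mem_range, h.isSplit.boundary_eq_iff]
  rw [h.isSplit.exists_isBoundary_iff]
  exact Prod.ext_iff

theorem Commuting.naturalHomMayerVietoris (h : Commuting U V) :
     NaturalHomMayerVietoris U V := by
  refine ⟨fun n => Functor.whiskerLeft (shiftFunctor C n) h.isSplit.boundaryNat ≫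
    Functor.whiskerRight (shiftFunctorAdd C n 1).inv (quotientYoneda (U ⊓ V)),
    fun X n Y => ⟨h.exact_homToSum_homFromSum Y _, ?_, ?_⟩⟩
  · intro φ
    rw [← h.exact_homFromSum_boundary Y _ φ]
    exact Preadditive.IsIso.comp_right_eq_zero (h.isSplit.boundary Y _ φ)
      ((quotientFunctor (U ⊓ V)).map ((shiftFunctorAdd C n 1).inv.app X))
  · intro (ψ : QuotientHom (U ⊓ V) Y (X⟦n + 1⟧))
    let i := (quotientFunctor (U ⊓ V)).mapIso ((shiftFunctorAdd C n 1).symm.app X)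
    obtain ⟨ψ, rfl⟩ : ∃ ψ' : QuotientHom (U ⊓ V) Y (X⟦n⟧⟦(1 : ℤ)⟧), ψ' ≫ i.hom = ψ :=
      ⟨ψ ≫ i.inv, (Category.assoc _ _ _).trans (by rw [i.inv_hom_id, Category.comp_id])⟩
    -- Kernels are described by factorizations, which are insensitive to the isomorphism `X⟦n⟧⟦1⟧ ≅
    -- X⟦n + 1⟧`.
    rw [homToSum_eq_zero_iff, quotientHomMap_eq_zero_iff, quotientHomMap_eq_zero_iff,
      factorsThrough_comp_iso_iff, factorsThrough_comp_iso_iff,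
      ← quotientHomMap_eq_zero_iff inf_le_left,
      ← quotientHomMap_eq_zero_iff inf_le_right, ← homToSum_eq_zero_iff, h.exact_boundary_homToSum]
    exact exists_congr fun φ => (cancel_mono i.hom).symm

end HomSequence

/-! ### Moving the shift from the second variable to the first. -/

section Desuspension

variable {C : Type u} [Category.{v} C] [HasZeroObject C] [HasShift C ℤ] [Preadditive C]
  [∀ n : ℤ, (shiftFunctor C n).Additive] [Pretriangulated C] [IsTriangulated C]
  [EssentiallySmall.{v} C]
variable (S : ObjectProperty C) [S.IsTriangulated]

/-- The shift of morphisms of a Verdier quotient. -/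
noncomputable def quotientHomShift (n : ℤ) {Y X : C} (f : QuotientHom S Y X) :
    QuotientHom S (Y⟦n⟧) (X⟦n⟧) :=
  ((quotientFunctor S).commShiftIso n).hom.app Y ≫ f⟦n⟧' ≫
    ((quotientFunctor S).commShiftIso n).inv.app X

theorem quotientHomShift_comp (n : ℤ) {Y X Z : C} (f : QuotientHom S Y X)
    (g : QuotientHom S X Z) :
    quotientHomShift S n (Y := Y) (X := Z) (f ≫ g) =
      quotientHomShift S n f ≫ quotientHomShift S n g := by
  simp [quotientHomShift]

theorem quotientHomShift_map (n : ℤ) {Y X : C} (f : Y ⟶ X) :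
    quotientHomShift S n ((quotientFunctor S).map f) = (quotientFunctor S).map (f⟦n⟧') := by
  simp [quotientHomShift]

theorem quotientHomShift_bijective (n : ℤ) (Y X : C) :
    Function.Bijective (quotientHomShift S n : QuotientHom S Y X → _) := by
  constructor
  · intro f g h
    exact (shiftFunctor (VerdierQuotient S) n).map_injective
      (by simpa [quotientHomShift, cancel_epi, cancel_mono] using h)
  · intro g
    obtain ⟨f, hf⟩ := (shiftFunctor (VerdierQuotient S) n).map_surjective
      (((quotientFunctor S).commShiftIso n).inv.app Y ≫ g ≫
        ((quotientFunctor S).commShiftIso n).hom.app X)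
    exact ⟨f, by simp [quotientHomShift, hf]⟩

/-- The bijection `Hom_{C / S}(Y, X⟦1⟧) ≃ Hom_{C / S}(Y⟦-1⟧, X)`. -/
noncomputable def desuspend (Y X : C) :
    QuotientHom S Y (X⟦(1 : ℤ)⟧) →+ QuotientHom S (Y⟦(-1 : ℤ)⟧) X :=
  AddMonoidHom.mk' (fun f => quotientHomShift S (-1) f ≫ (quotientFunctor S).map
    ((shiftFunctorCompIsoId C (1 : ℤ) (-1) (by omega)).hom.app X))
    (fun f g => by simp [quotientHomShift, Functor.map_add])

theorem desuspend_apply {Y X : C} (f : QuotientHom S Y (X⟦(1 : ℤ)⟧)) :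
    desuspend S Y X f = quotientHomShift S (-1) f ≫ (quotientFunctor S).map
      ((shiftFunctorCompIsoId C (1 : ℤ) (-1) (by omega)).hom.app X) := rfl

theorem desuspend_bijective (Y X : C) : Function.Bijective (desuspend S Y X) := by
  let i := (quotientFunctor S).mapIso ((shiftFunctorCompIsoId C (1 : ℤ) (-1) (by omega)).app X)
  exact (Iso.homToEquiv i).bijective.comp (quotientHomShift_bijective S (-1) Y (X⟦(1 : ℤ)⟧))

theorem desuspend_precomp {Z Y X : C} (b : Z ⟶ Y) (f : QuotientHom S Y (X⟦(1 : ℤ)⟧)) :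
    desuspend S Z X ((quotientFunctor S).map b ≫ f) =
      (quotientFunctor S).map (b⟦(-1 : ℤ)⟧') ≫ desuspend S Y X f := by
  simp [desuspend, quotientHomShift_comp, quotientHomShift_map]

theorem desuspend_postcomp {Y X X' : C} (f : QuotientHom S Y (X⟦(1 : ℤ)⟧)) (a : X ⟶ X') :
    desuspend S Y X' (f ≫ (quotientFunctor S).map (a⟦(1 : ℤ)⟧')) =
      desuspend S Y X f ≫ (quotientFunctor S).map a := by
  have := (shiftFunctorCompIsoId C (1 : ℤ) (-1) (by omega)).hom.naturality a
  dsimp only [Functor.comp_map, Functor.id_map] at this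
  rw [desuspend_apply, desuspend_apply, quotientHomShift_comp, quotientHomShift_map,
    Category.assoc, Category.assoc,
    ← Functor.map_comp, ← Functor.map_comp, this]

/-- The maps `desuspend`, as a natural transformation. -/
noncomputable def desuspendNat :
    shiftFunctor C (1 : ℤ) ⋙ quotientYoneda S ⟶
      quotientYoneda S ⋙ (Functor.whiskeringLeft _ _ _).obj (shiftFunctor C (-1 : ℤ)).op where
  app X :=
    { app := fun Y => AddCommGrpCat.ofHom (desuspend S Y.unop X)
      naturality := fun Y Z b => by
        ext f
        exact desuspend_precomp S b.unop f }
  naturality X X' a := by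
    ext Y f
    exact desuspend_postcomp S (show QuotientHom S Y.unop (X⟦(1 : ℤ)⟧) from f) a

/-- Exactness involves only the kernels of the canonical maps. These consist of morphisms factoring
through `S'`, which is stable under shifts, so no compatibility of `quotientMap` with shifts is
needed. -/
theorem quotientHomMap_desuspend_eq_zero_iff {S' : ObjectProperty C} [S'.IsTriangulated]
    (h : S ≤ S') {Y X : C} (f : QuotientHom S Y (X⟦(1 : ℤ)⟧)) :
    quotientHomMap h _ _ (desuspend S Y X f) = 0 ↔ quotientHomMap h _ _ f = 0 := by
  constructor
  · intro hf
    obtain ⟨Z, a, k, hZ, hk⟩ := exists_comp_map_of_quotientHomMap_eq_zero h _ hf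
    obtain ⟨a, rfl⟩ := (desuspend_bijective S Y Z).2 a
    rw [← desuspend_postcomp] at hk
    rw [← (desuspend_bijective S Y X).1 hk]
    exact FactorsThrough.quotientHomMap_eq_zero h
      ⟨Z⟦(1 : ℤ)⟧, a, _, S'.le_shift 1 _ hZ, rfl⟩
  · intro hf
    rw [quotientHomMap_eq_zero_iff] at hf
    obtain ⟨Z, a, b, hZ, rfl⟩ := hf
    refine FactorsThrough.quotientHomMap_eq_zero h ⟨Z⟦(-1 : ℤ)⟧, quotientHomShift S (-1) a,
      quotientHomShift S (-1) b ≫ (quotientFunctor S).map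
        ((shiftFunctorCompIsoId C (1 : ℤ) (-1) (by omega)).hom.app X),
      S'.le_shift (-1) _ hZ, ?_⟩
    simp [desuspend, quotientHomShift_comp]

end Desuspension

end TriangulatedMV

namespace TriangulatedMV

open Pretriangulated

/-! ### Elements of the localisation functors. -/

section Elements

theorem preservesColimitsOfShape_forget {C : Type u} [Category.{v} C] [HasZeroObject C]
    [HasShift C ℤ] [Preadditive C] [∀ n : ℤ, (shiftFunctor C n).Additive] [Pretriangulated C]
    [EssentiallySmall.{v} C] (F : Coh C) :
    PreservesColimitsOfShape (CostructuredArrow (cohYoneda C) F)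
      (forget AddCommGrpCat.{v}) :=
  have : IsFiltered (SmallModel.{v} (CostructuredArrow (cohYoneda C) F)) :=
    .of_equivalence (equivSmallModel _)
  preservesColimitsOfShape_of_equiv (equivSmallModel.{v} _).symm _

variable {C : Type u} [Category.{v} C] [HasZeroObject C] [HasShift C ℤ] [Preadditive C]
  [∀ n : ℤ, (shiftFunctor C n).Additive] [Pretriangulated C] [IsTriangulated C]
  [EssentiallySmall.{v} C] (S : ObjectProperty C) [S.IsTriangulated]

/-- The map `Hom_{C / S}(Y, X) → (L_S F)(Y)` attached to a morphism `H_X ⟶ F`. -/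
noncomputable def locElem {F : Coh C} {X : C} (x : (cohYoneda C).obj X ⟶ F) (Y : C) :
    QuotientHom S Y X →+ ((locFunctor S).obj F).obj.obj (op Y) :=
  (((locUnit S).app X ≫ ((locFunctor S ⋙ ObjectProperty.ι _).map x)).app (op Y)).hom

theorem locElem_postcomp {F : Coh C} {X X' Y : C} (x : (cohYoneda C).obj X' ⟶ F) (a : X ⟶ X')
    (f : QuotientHom S Y X) :
    locElem S x Y (f ≫ (quotientFunctor S).map a) =
      locElem S ((cohYoneda C).map a ≫ x) Y f := by
  have h₁ := (locUnit S).naturality a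
  have h₂ := (locFunctor S ⋙ ObjectProperty.ι _).map_comp ((cohYoneda C).map a) x
  have h₃ : (quotientYoneda S).map a ≫ (locUnit S).app X' ≫
      (locFunctor S ⋙ ObjectProperty.ι _).map x = (locUnit S).app X ≫
        (locFunctor S ⋙ ObjectProperty.ι _).map ((cohYoneda C).map a ≫ x) := by
    rw [h₂]
    exact (Category.assoc _ _ _).symm.trans ((congrArg (· ≫ _) h₁).trans (Category.assoc _ _ _))
  exact ConcreteCategory.congr_hom (congr_app h₃ (op Y)) f

/-- The group `(L_S F)(Y)` as a colimit of the groups `Hom_{C / S}(Y, X)`. -/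
noncomputable def locIsColimit (F : Coh C) (Y : C) :
    IsColimit (((evaluation Cᵒᵖ AddCommGrpCat.{v}).obj (op Y)).mapCocone
      ((Functor.LeftExtension.mk (locFunctor S ⋙ ObjectProperty.ι _)
        (locUnit S)).coconeAt F)) :=
  have := hasColimitsOfShape_of_essentiallySmall.{v}
    (CostructuredArrow (cohYoneda C) F) AddCommGrpCat.{v}
  isColimitOfPreserves _ (locUnitIsPointwise S F)

theorem exists_locElem_eq {F : Coh C} {Y : C} (z : ((locFunctor S).obj F).obj.obj (op Y)) :
    ∃ (X : C) (x : (cohYoneda C).obj X ⟶ F) (f : QuotientHom S Y X), locElem S x Y f = z := by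
  have := preservesColimitsOfShape_forget F
  obtain ⟨j, f, hf⟩ := Concrete.isColimit_exists_rep _ (locIsColimit S F Y) z
  exact ⟨j.left, j.hom, f, hf⟩

theorem locElem_eq_zero_iff {F : Coh C} {X Y : C} (x : (cohYoneda C).obj X ⟶ F)
    (f : QuotientHom S Y X) :
    locElem S x Y f = 0 ↔ ∃ (X' : C) (a : X ⟶ X') (x' : (cohYoneda C).obj X' ⟶ F),
      (cohYoneda C).map a ≫ x' = x ∧ f ≫ (quotientFunctor S).map a = 0 := by
  constructor
  · intro h
    have := preservesColimitsOfShape_forget F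
    let j := CostructuredArrow.mk x
    -- Filteredness yields two possibly different arrows `a`, `b` identifying `f` with `0`; the
    -- image of `0` under `b` is still `0`.
    obtain ⟨k, a, b, hab⟩ := Concrete.isColimit_exists_of_rep_eq _ (locIsColimit S F Y)
      (i := j) (j := j) f (0 : QuotientHom S Y X) (h.trans (map_zero (locElem S x Y)).symm)
    exact ⟨k.left, a.left, k.hom, CostructuredArrow.w a, hab.trans
      (show (0 : QuotientHom S Y X) ≫ (quotientFunctor S).map b.left = 0 from zero_comp)⟩
  · rintro ⟨X', a, x', rfl, hf⟩
    rw [← locElem_postcomp, hf, map_zero]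

theorem exists_locElem_eq_and_eq {S' : ObjectProperty C} [S'.IsTriangulated] {F : Coh C} {Y : C}
    (z : ((locFunctor S).obj F).obj.obj (op Y)) (z' : ((locFunctor S').obj F).obj.obj (op Y)) :
    ∃ (X : C) (x : (cohYoneda C).obj X ⟶ F) (f : QuotientHom S Y X) (f' : QuotientHom S' Y X),
      locElem S x Y f = z ∧ locElem S' x Y f' = z' := by
  obtain ⟨X, x, f, rfl⟩ := exists_locElem_eq S z
  obtain ⟨X', x', f', rfl⟩ := exists_locElem_eq S' z'
  let j := CostructuredArrow.mk x
  let j' := CostructuredArrow.mk x'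
  refine ⟨_, (IsFiltered.max j j').hom,
    f ≫ (quotientFunctor S).map (IsFiltered.leftToMax j j').left,
    f' ≫ (quotientFunctor S').map (IsFiltered.rightToMax j j').left, ?_, ?_⟩
  · rw [locElem_postcomp, CostructuredArrow.w]
    rfl
  · rw [locElem_postcomp, CostructuredArrow.w]
    rfl

theorem locMapApp_locElem {S S' : ObjectProperty C} [S.IsTriangulated] [S'.IsTriangulated]
    (h : S ≤ S') {F : Coh C} {X Y : C} (x : (cohYoneda C).obj X ⟶ F) (f : QuotientHom S Y X) :
    locMapApp h F Y (locElem S x Y f) = locElem S' x Y (quotientHomMap h Y X f) := by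
  have h₁ := ConcreteCategory.congr_hom (congr_app (congr_app (locUnit_locMap h) X) (op Y)) f
  have h₂ := ConcreteCategory.congr_hom
    (congr_app (congrArg InducedCategory.Hom.hom ((locMap h).naturality x)) (op Y))
    (((locUnit S).app X).app (op Y) f)
  exact h₂.trans (congrArg (((locFunctor S').map x).hom.app (op Y)) h₁)

/-- Every arrow out of the identity of `H_X` in the slice category has an underlying split
monomorphism, so passing to the colimit kills nothing. -/
theorem eq_zero_of_locElem_id_eq_zero {Y X : C} (f : QuotientHom S Y X)
    (h : locElem S (𝟙 ((cohYoneda C).obj X)) Y f = 0) : f = 0 := by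
  obtain ⟨X', a, x', hx', hf⟩ := (locElem_eq_zero_iff S _ f).1 h
  obtain ⟨b, rfl⟩ := ofElem_surj _ x'
  have hab : a ≫ (show X' ⟶ X from b) = 𝟙 X := by
    rw [map_ofElem] at hx'
    have := ConcreteCategory.congr_hom
      (congr_app (congrArg InducedCategory.Hom.hom hx') (op X)) (𝟙 X)
    exact (Category.id_comp _).symm.trans this
  rw [← Category.comp_id f, ← CategoryTheory.Functor.map_id, ← hab, Functor.map_comp,
    reassoc_of% hf, zero_comp]

end Elements

/-! ### The sequence of localisation functors, and the converse implications. -/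

section MayerVietoris

variable {C : Type u} [Category.{v} C] [HasZeroObject C] [HasShift C ℤ] [Preadditive C]
  [∀ n : ℤ, (shiftFunctor C n).Additive] [Pretriangulated C] [IsTriangulated C]
  [EssentiallySmall.{v} C] {U V : ObjectProperty C} [U.IsTriangulated] [V.IsTriangulated]

theorem locFromSum_locElem [V.IsStableUnderRetracts] {F : Coh C}
    {X Y : C} (x : (cohYoneda C).obj X ⟶ F)
    (p : QuotientHom U Y X × QuotientHom V Y X) :
    locFromSum U V F Y (locElem U x Y p.1, locElem V x Y p.2) =
      locElem (thickJoin U V) x Y (homFromSum U V Y X p) := by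
  rw [homFromSum_apply, map_sub, ← locMapApp_locElem, ← locMapApp_locElem, sub_eq_add_neg]
  rfl

variable [U.IsStableUnderRetracts]

theorem locToSum_locElem {F : Coh C} {X Y : C} (x : (cohYoneda C).obj X ⟶ F)
    (f : QuotientHom (U ⊓ V) Y X) :
    locToSum U V F Y (locElem (U ⊓ V) x Y f) =
      (locElem U x Y (homToSum U V Y X f).1, locElem V x Y (homToSum U V Y X f).2) :=
  Prod.ext (locMapApp_locElem _ x f) (locMapApp_locElem _ x f)

theorem commuting_of_map_eq_zero (h : ∀ ⦃X Y : C⦄ (f : X ⟶ Y), thickJoin U V X →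
    (quotientFunctor U).map f = 0 → (quotientFunctor V).map f = 0 →
      (quotientFunctor (U ⊓ V)).map f = 0) :
    Commuting U V :=
  ⟨fun _ _ f hX hY => exists_comp_eq_zero_of_map_eq_zero _ f (h f (left_le_thickJoin U V _ hX)
      ((isZero_quotientFunctor_obj U hX).eq_of_src _ _)
      ((isZero_quotientFunctor_obj V hY).eq_of_tgt _ _)),
    fun _ _ f hX hY => exists_comp_eq_zero_of_map_eq_zero _ f (h f (right_le_thickJoin U V _ hX)
      ((isZero_quotientFunctor_obj U hY).eq_of_tgt _ _)
      ((isZero_quotientFunctor_obj V hX).eq_of_src _ _))⟩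

theorem homToSum_map_eq_zero {X Y : C} (f : X ⟶ Y) (hU : (quotientFunctor U).map f = 0)
    (hV : (quotientFunctor V).map f = 0) :
    homToSum U V X Y ((quotientFunctor (U ⊓ V)).map f) = 0 :=
  Prod.ext ((quotientHomMap_map _ f).trans hU) ((quotientHomMap_map _ f).trans hV)

variable [V.IsStableUnderRetracts]

/-- The connecting morphism on representable functors, with values in `Σ L_{U ∧ V}`. -/
noncomputable def Commuting.locBoundaryUnit (h : Commuting U V) :
    quotientYoneda (thickJoin U V) ⟶
      cohYoneda C ⋙ (locFunctor (U ⊓ V) ⋙ cohSuspension) ⋙ ObjectProperty.ι _ :=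
  h.isSplit.boundaryNat ≫ desuspendNat (U ⊓ V) ≫
    Functor.whiskerRight (locUnit (U ⊓ V))
      ((Functor.whiskeringLeft _ _ _).obj (shiftFunctor C (-1 : ℤ)).op)

/-- The connecting morphism `L_{U ∨ V} ⟶ Σ L_{U ∧ V}` for commuting `U` and `V`. -/
noncomputable def Commuting.locBoundary (h : Commuting U V) :
    locFunctor (thickJoin U V) ⟶ locFunctor (U ⊓ V) ⋙ cohSuspension :=
  (Functor.FullyFaithful.whiskeringRight (ObjectProperty.fullyFaithfulι _) (Coh C)).preimage
    ((locFunctor (thickJoin U V) ⋙ ObjectProperty.ι _).descOfIsLeftKanExtension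
      (locUnit (thickJoin U V)) ((locFunctor (U ⊓ V) ⋙ cohSuspension) ⋙ ObjectProperty.ι _)
      h.locBoundaryUnit)

theorem Commuting.locUnit_locBoundary (h : Commuting U V) :
    locUnit (thickJoin U V) ≫ Functor.whiskerLeft (cohYoneda C)
      (Functor.whiskerRight h.locBoundary (ObjectProperty.ι _)) = h.locBoundaryUnit :=
  (locFunctor (thickJoin U V) ⋙ ObjectProperty.ι _).descOfIsLeftKanExtension_fac
    (locUnit (thickJoin U V)) _ _

theorem Commuting.locBoundary_locElem (h : Commuting U V) {F : Coh C} {X Y : C}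
    (x : (cohYoneda C).obj X ⟶ F) (φ : QuotientHom (thickJoin U V) Y X) :
    (h.locBoundary.app F).hom.app (op Y) (locElem (thickJoin U V) x Y φ) =
      locElem (U ⊓ V) x (Y⟦(-1 : ℤ)⟧)
        (desuspend (U ⊓ V) Y X (h.isSplit.boundary Y X φ)) := by
  have h₁ := ConcreteCategory.congr_hom
    (congr_app (congr_app h.locUnit_locBoundary X) (op Y)) φ
  have h₂ := ConcreteCategory.congr_hom
    (congr_app (congrArg InducedCategory.Hom.hom (h.locBoundary.naturality x)) (op Y))
    (((locUnit (thickJoin U V)).app X).app (op Y) φ)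
  exact h₂.trans (congrArg (((locFunctor (U ⊓ V)).map x).hom.app (op (Y⟦(-1 : ℤ)⟧))) h₁)

theorem Commuting.exact_desuspend_boundary (h : Commuting U V) (Y X : C) :
    Function.Exact (fun φ => desuspend (U ⊓ V) Y X (h.isSplit.boundary Y X φ))
      (homToSum U V (Y⟦(-1 : ℤ)⟧) X) := by
  intro ψ
  obtain ⟨ψ, rfl⟩ := (desuspend_bijective (U ⊓ V) Y X).2 ψ
  rw [homToSum_eq_zero_iff, quotientHomMap_desuspend_eq_zero_iff,
    quotientHomMap_desuspend_eq_zero_iff, ← homToSum_eq_zero_iff, h.exact_boundary_homToSum]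
  simp only [Set.mem_range, (desuspend_bijective (U ⊓ V) Y X).1.eq_iff]

theorem Commuting.locMayerVietoris (h : Commuting U V) : LocMayerVietoris U V := by
  refine ⟨h.locBoundary, fun F Y => ⟨?_, ?_, ?_⟩⟩
  · rintro ⟨z, z'⟩
    constructor
    · obtain ⟨X, x, α, β, rfl, rfl⟩ := exists_locElem_eq_and_eq U z z'
      intro hz
      -- An element vanishing in the colimit vanishes at a later stage `X'`, where the sequence of
      -- morphism groups is exact.
      rw [locFromSum_locElem x (α, β), locElem_eq_zero_iff] at hz
      obtain ⟨X', a, x', rfl, hz⟩ := hz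
      have : homFromSum U V Y X' (α ≫ (quotientFunctor U).map a,
          β ≫ (quotientFunctor V).map a) = 0 := by
        rw [← hz, homFromSum_apply, homFromSum_apply, Preadditive.sub_comp,
          quotientHomMap_postcomp, quotientHomMap_postcomp]
      obtain ⟨γ, hγ⟩ := (h.exact_homToSum_homFromSum Y X' _).1 this
      refine ⟨locElem (U ⊓ V) x' Y γ, ?_⟩
      rw [locToSum_locElem, hγ, locElem_postcomp, locElem_postcomp]
    · rintro ⟨z'', hz''⟩
      obtain ⟨X, x, γ, rfl⟩ := exists_locElem_eq (U ⊓ V) z''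
      rw [← hz'', locToSum_locElem, locFromSum_locElem,
        (h.exact_homToSum_homFromSum Y X).apply_apply_eq_zero, map_zero]
  · intro z
    constructor
    · obtain ⟨X, x, φ, rfl⟩ := exists_locElem_eq (thickJoin U V) z
      intro hz
      rw [h.locBoundary_locElem] at hz
      obtain ⟨X', a, x', rfl, hφ⟩ := (locElem_eq_zero_iff _ _ _).1 hz
      rw [← desuspend_postcomp, map_eq_zero_iff _ (desuspend_bijective _ _ _).1] at hφ
      have hn := (h.isSplit.boundary_eq_iff _ _).2
        (h.isSplit.isBoundary_postcomp _ ((h.isSplit.boundary_eq_iff φ _).1 rfl) a)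
      obtain ⟨p, hp⟩ := (h.exact_homFromSum_boundary Y X' _).1 (hn.trans hφ)
      refine ⟨(locElem U x' Y p.1, locElem V x' Y p.2), ?_⟩
      rw [locFromSum_locElem, hp, locElem_postcomp]
    · rintro ⟨⟨z', z''⟩, rfl⟩
      obtain ⟨X, x, α, β, rfl, rfl⟩ := exists_locElem_eq_and_eq U z' z''
      rw [locFromSum_locElem x (α, β), h.locBoundary_locElem,
        (h.exact_homFromSum_boundary Y X).apply_apply_eq_zero, map_zero, map_zero]
      rfl
  · intro z
    constructor
    · obtain ⟨X, x, ψ, rfl⟩ := exists_locElem_eq (U ⊓ V) (Y := Y⟦(-1 : ℤ)⟧) z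
      intro hz
      rw [locToSum_locElem] at hz
      obtain ⟨X', a, x', rfl, hα⟩ := (locElem_eq_zero_iff _ _ _).1 (Prod.ext_iff.1 hz).1
      have hz' := (Prod.ext_iff.1 hz).2
      dsimp only at hz'
      rw [← locElem_postcomp] at hz'
      -- Two moves are made: at `X'` the component in `C / U` dies, at `X''` also the one in `C /
      -- V`.
      obtain ⟨X'', a', x'', rfl, hβ⟩ := (locElem_eq_zero_iff _ _ _).1 hz'
      have h0 : homToSum U V _ _ ((ψ ≫ (quotientFunctor (U ⊓ V)).map a) ≫
          (quotientFunctor (U ⊓ V)).map a') = 0 := by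
        rw [homToSum_eq_zero_iff, quotientHomMap_postcomp, quotientHomMap_postcomp,
          quotientHomMap_postcomp, quotientHomMap_postcomp]
        exact ⟨(congrArg (· ≫ _) hα).trans zero_comp, hβ⟩
      obtain ⟨φ, hφ⟩ := (h.exact_desuspend_boundary Y X'' _).1 h0
      refine ⟨locElem (thickJoin U V) x'' Y φ, ?_⟩
      rw [h.locBoundary_locElem]
      refine (congrArg _ hφ).trans ?_
      rw [locElem_postcomp, locElem_postcomp]
    · rintro ⟨z', rfl⟩
      obtain ⟨X, x, φ, rfl⟩ := exists_locElem_eq (thickJoin U V) z'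
      rw [h.locBoundary_locElem, locToSum_locElem,
        (h.exact_desuspend_boundary Y X).apply_apply_eq_zero]
      simp

theorem commuting_of_pointwiseHomMayerVietoris
    (h : ∀ Y X : C, PointwiseHomMayerVietoris U V Y X) : Commuting U V := by
  refine commuting_of_map_eq_zero fun X Y f hX hU hV => ?_
  -- Taking `Y⟦-1⟧` and `n = 0` puts `Y` in the target of the connecting map; the index keeps the
  -- form `0 + 1` of the sequence.
  let i : Y⟦(-1 : ℤ)⟧⟦(0 + 1 : ℤ)⟧ ≅ Y :=
    (shiftFunctorCompIsoId C (-1 : ℤ) (0 + 1) (by omega)).app Y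
  obtain ⟨β, δ, hδ⟩ := h X (Y⟦(-1 : ℤ)⟧)
  obtain ⟨φ, hφ⟩ := ((hδ 0).2.2 ((quotientFunctor (U ⊓ V)).map (f ≫ i.inv))).1
    (homToSum_map_eq_zero _ (by rw [Functor.map_comp, hU, zero_comp])
      (by rw [Functor.map_comp, hV, zero_comp]))
  rw [quotientHom_eq_zero_left _ hX φ, map_zero] at hφ
  rw [← Category.comp_id f, ← i.inv_hom_id, ← Category.assoc, Functor.map_comp, ← hφ, zero_comp]

theorem commuting_of_locMayerVietoris (h : LocMayerVietoris U V) : Commuting U V := by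
  refine commuting_of_map_eq_zero fun X Y f hX hU hV => ?_
  obtain ⟨δ, hδ⟩ := h
  -- The sequence is evaluated at `X⟦1⟧`, so that `Σ L_{U ∧ V}` takes the value of `L_{U ∧ V}` at an
  -- object isomorphic to `X`, while `X⟦1⟧` stays in `U ∨ V`.
  let i : X⟦(1 : ℤ)⟧⟦(-1 : ℤ)⟧ ≅ X := (shiftFunctorCompIsoId C (1 : ℤ) (-1) (by omega)).app X
  let z := locElem (U ⊓ V) (𝟙 ((cohYoneda C).obj Y)) (X⟦(1 : ℤ)⟧⟦(-1 : ℤ)⟧)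
    ((quotientFunctor (U ⊓ V)).map (i.hom ≫ f))
  have hz : locToSum U V _ _ z = 0 := by
    rw [locToSum_locElem, homToSum_map_eq_zero _ (by rw [Functor.map_comp, hU, comp_zero])
      (by rw [Functor.map_comp, hV, comp_zero])]
    simp
  obtain ⟨w, hw⟩ := ((hδ _ _).2.2 z).1 hz
  obtain ⟨X', x, φ, rfl⟩ := exists_locElem_eq (thickJoin U V) w
  have hX' : thickJoin U V (X⟦(1 : ℤ)⟧) := (thickJoin U V).le_shift 1 _ hX
  rw [quotientHom_eq_zero_left _ hX' φ, map_zero, map_zero] at hw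
  have := eq_zero_of_locElem_id_eq_zero _ _ hw.symm
  rw [← Category.id_comp f, ← i.inv_hom_id, Category.assoc, Functor.map_comp, this, comp_zero]

end MayerVietoris

end TriangulatedMV

theorem mainTheorem1 {C : Type u} [Category.{v} C] [HasZeroObject C] [HasShift C ℤ]
    [Preadditive C] [∀ n : ℤ, (shiftFunctor C n).Additive] [Pretriangulated C]
    [IsTriangulated C] [EssentiallySmall.{v} C]
    (U V : ObjectProperty C) [U.IsTriangulated] [U.IsStableUnderRetracts]
    [V.IsTriangulated] [V.IsStableUnderRetracts] :
    List.TFAE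
      [TriangulatedMV.Commuting U V,
        TriangulatedMV.LocMayerVietoris U V,
        ∀ X : C, TriangulatedMV.HomMayerVietoris U V X,
        TriangulatedMV.NaturalHomMayerVietoris U V,
        ∀ Y X : C, TriangulatedMV.PointwiseHomMayerVietoris U V Y X] := by
  tfae_have 1 → 2 := fun h => h.locMayerVietoris
  tfae_have 2 → 1 := TriangulatedMV.commuting_of_locMayerVietoris
  tfae_have 1 → 4 := fun h => h.naturalHomMayerVietoris
  tfae_have 4 → 3 := fun ⟨δ, hδ⟩ X => ⟨fun n => (δ n).app X, hδ X⟩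
  tfae_have 3 → 5 := fun h Y X => by
    obtain ⟨δ, hδ⟩ := h X
    exact ⟨fun n => TriangulatedMV.homFromSum U V Y (X⟦n⟧), fun n => ((δ n).app (op Y)).hom,
      fun n => hδ n Y⟩
  tfae_have 5 → 1 := TriangulatedMV.commuting_of_pointwiseHomMayerVietoris
  tfae_finish
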